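/- Let $p$ be a prime and let $R$ be a $p$-adically complete (and separated) integral domain of characteristic zero. Let $f\in R[x_1^{\pm1},\dots,x_n^{\pm1}]$ be a Laurent polynomial with Newton polytope $\Delta\subset\mathbb R^n$, and let $b$ be a vertex of $\Delta$ at which the coefficient of $f$ is a unit of $R$. Let $\mu\subseteq\Delta$ be open, i.e. $\Delta\setminus\mu$ is a union of faces of $\Delta$, and put $\mu_{\mathbb Z}=\mu\cap\mathbb Z^n$, $h=\#\mu_{\mathbb Z}$, $\omega_u=x^u/f$ for $u\in\mu_{\mathbb Z}$. Rational functions $g/f^k$ are expanded at $b$ into formal Laurent series supported in the cone $C(\Delta-b)$. For a Frobenius lift $\sigma$ (a ring endomorphism of $R$ with $\sigma(r)\equiv r^p \bmod p$ for all $r$), let $f^\sigma$ be $f$ with $\sigma$ applied to its coefficients, with corresponding functions $\omega_u^\sigma=x^u/f^\sigma$. Let $\Omega_f(\mu)$ be the $R$-module generated by all $(k-1)!\,g/f^k$ with $k\ge1$ and $\mathrm{supp}(g)\subset k\mu$, and let $\widehat\Omega_f(\mu)$ be its $p$-adic completion if $p$ is odd, and its closure in the $2$-adic topology of formal Laurent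 series if $p=2$; both are regarded as modules of formal series. $\Omega_{f^{\sigma^s}}(\mu)$ and $\widehat\Omega_{f^{\sigma^s}}(\mu)$ are defined in the same way, with the same $\mu$ and $b$. Let $\mathscr C_p(\sum a_k x^k)=\sum a_{pk}x^k$ be the Cartier operator and $$U_f(\mu)=\{\omega\in\widehat\Omega_f(\mu)\;:\;\mathscr C_p^s(\omega)\in p^s\,\widehat\Omega_{f^{\sigma^s}}(\mu)\ \text{ for all } s\ge1\}.$$ Choose elements $\phi_v\in R$ $(v\in\Delta_{\mathbb Z})$ and for $m\ge1$ let $\gamma_m=\gamma_m(\mu)\in R^{h\times h}$ be the matrix with entries $$(\gamma_m)_{u,v}=\text{constant term of }\bigl(\phi_v^m-(\phi_v-f/x^v)^m\bigr)\,\omega_u,\qquad u,v\in\mu_{\mathbb Z}.$$ Suppose that $\gamma_p$ is invertible over $R$. Then for every Frobenius lift $\sigma$ and every derivation $\delta$ of $R$ (acting on series through their coefficients) there are unique matrices $\Lambda_\sigma,N_\delta\in R^{h\times h}$ with $$\mathscr C_p(\omega_u)\equiv\sum_{v\in\mu_{\mathbb Z}}(\Lambda_\sigma)_{u,v}\,\omega_v^\sigma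 \bmod U_{f^\sigma}(\mu),\qquad \delta(\omega_u)\equiv\sum_{v\in\mu_{\mathbb Z}}(N_\delta)_{u,v}\,\omega_v \bmod U_f(\mu)\qquad(u\in\mu_{\mathbb Z}),$$ and for all $m\ge1$ $$\gamma_m\equiv\Lambda_\sigma\,\sigma(\gamma_{m/p})\quad\text{and}\quad \delta(\gamma_m)\equiv N_\delta\,\gamma_m \pmod{p^{\mathrm{ord}_p(m)}}$$ (the first congruence is empty when $p\nmid m$). Moreover all $\gamma_{p^s}$, $s\ge0$, are invertible over $R$, and for all $s\ge1$ $$\Lambda_\sigma\equiv\gamma_{p^s}\,\sigma(\gamma_{p^{s-1}})^{-1}\quad\text{and}\quad N_\delta\equiv\delta(\gamma_{p^s})\,\gamma_{p^s}^{-1}\pmod{p^s}.$$ -/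

import Mathlib

open scoped Pointwise

noncomputable section

namespace DworkCrystal

variable {R : Type*} [CommRing R] {n : ℕ}

/-- Laurent polynomials in `n` variables: `g.coeff u` is the coefficient of `x^u`. -/
abbrev Laurent (R : Type*) [CommRing R] (n : ℕ) := AddMonoidAlgebra R (Fin n → ℤ)

/-- Formal Laurent series `∑ a_w x^w`, `w ∈ ℤⁿ`, as coefficient functions. Only series supported
in the cone `C(Δ - b)` of a vertex `b` occur below. -/
abbrev Formal (R : Type*) (n : ℕ) := (Fin n → ℤ) → R

/-- An exponent vector as a point of `ℝⁿ`. -/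
def toReal (u : Fin n → ℤ) : Fin n → ℝ := fun i => (u i : ℝ)

/-- The Newton polytope of a Laurent polynomial. -/
def newtonPolytope (f : Laurent R n) : Set (Fin n → ℝ) :=
  convexHull ℝ (toReal '' (f.coeff.support : Set (Fin n → ℤ)))

/-- A subset `μ` of a polytope `Δ` is open if its complement in `Δ` is a union of faces. -/
def IsOpenIn (Δ μ : Set (Fin n → ℝ)) : Prop :=
  μ ⊆ Δ ∧ ∃ 𝓕 : Set (Set (Fin n → ℝ)), (∀ F ∈ 𝓕, IsExposed ℝ Δ F) ∧ Δ \ μ = ⋃₀ 𝓕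

theorem finite_latticePoints (f : Laurent R n) (μ : Set (Fin n → ℝ)) :
    {u : Fin n → ℤ | toReal u ∈ newtonPolytope f ∧ toReal u ∈ μ}.Finite := by
  have hb : Bornology.IsBounded (newtonPolytope f) :=
    isBounded_convexHull.2 ((f.coeff.support.finite_toSet.image _).isBounded)
  obtain ⟨C, hC⟩ := hb.exists_norm_le
  refine (Set.finite_Icc (fun _ : Fin n => -⌈C⌉) (fun _ => ⌈C⌉)).subset ?_
  rintro u ⟨hu, -⟩
  have h1 : ∀ i, |(u i : ℝ)| ≤ ⌈C⌉ := fun i =>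
    ((norm_le_pi_norm (toReal u) i).trans (hC _ hu)).trans (Int.le_ceil C)
  refine ⟨fun i => ?_, fun i => ?_⟩
  · exact_mod_cast (abs_le.1 (h1 i)).1
  · exact_mod_cast (abs_le.1 (h1 i)).2

/-- The integral points of a subset `μ` of the Newton polytope of `f`. -/
def latticePoints (f : Laurent R n) (μ : Set (Fin n → ℝ)) : Finset (Fin n → ℤ) :=
  (finite_latticePoints f μ).toFinset

/-- The product of a Laurent polynomial and a formal Laurent series. -/
def polyMul (P : Laurent R n) (a : Formal R n) : Formal R n :=
  fun w => P.coeff.sum fun k c => c * a (w - k)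

/-- The expansion of the rational function `g / f^k` at a vertex `b` where the coefficient `f_b` is
a unit: writing `f = f_b x^b (1 + h)`, it is
`f_b^{-k} x^{-kb} g ∑_r (-k choose r) h^r`.
For every exponent `w` only finitely many `r` contribute. -/
def expansion (f : Laurent R n) (b : Fin n → ℤ) (g : Laurent R n) (k : ℕ) : Formal R n :=
  fun w => ∑ᶠ r : ℕ, Ring.inverse (f.coeff b) ^ k * ((Ring.choose (-(k : ℤ)) r : ℤ) : R) *
    (g * (AddMonoidAlgebra.single (-b) (Ring.inverse (f.coeff b)) * f - 1) ^ r).coeff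
      (w + (k : ℤ) • b)

/-- `ω_u = x^u / f`. -/
def omega (f : Laurent R n) (b u : Fin n → ℤ) : Formal R n :=
  expansion f b (AddMonoidAlgebra.single u 1) 1

/-- The `R`-module `Ω_f(μ)` generated by all `(k-1)! g / f^k` with `k ≥ 1`, `supp g ⊆ kμ`
(embedded in formal series by expansion at the vertex `b`). -/
def Omega (f : Laurent R n) (b : Fin n → ℤ) (μ : Set (Fin n → ℝ)) : Submodule R (Formal R n) :=
  Submodule.span R {a | ∃ (k : ℕ) (g : Laurent R n), 1 ≤ k ∧
    (∀ u ∈ g.coeff.support, toReal u ∈ (k : ℝ) • μ) ∧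
    a = ((k - 1).factorial : R) • expansion f b g k}

/-- The completion of `Ω_f(μ)` inside formal series. For odd `p` it is the `p`-adic completion
`lim Ω_f(μ) / p^s Ω_f(μ)`, mapped to formal series (which are `p`-adically complete when `R` is).
For `p = 2` the Cartier operator does not preserve that module; there the closure of `Ω_f(μ)` in
the `2`-adic topology of formal series is taken. -/
def OmegaHat (p : ℕ) (f : Laurent R n) (b : Fin n → ℤ) (μ : Set (Fin n → ℝ)) :
    Submodule R (Formal R n) :=
  if p = 2 then
    ⨅ s : ℕ, Omega f b μ ⊔ (Ideal.span {(p : R)} ^ s • (⊤ : Submodule R (Formal R n)))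
  else
    (LinearMap.range ((AdicCompletion.map (Ideal.span {(p : R)})
      (Omega f b μ).subtype).restrictScalars R)).comap
        (AdicCompletion.of (Ideal.span {(p : R)}) (Formal R n))

/-- The Cartier operator `∑ a_w x^w ↦ ∑ a_{pw} x^w`. -/
def cartier (p : ℕ) (a : Formal R n) : Formal R n := fun w => a ((p : ℤ) • w)

/-- `f^σ`: the ring endomorphism `σ` applied to the coefficients of `f`. -/
def twist (σ : R →+* R) (f : Laurent R n) : Laurent R n :=
  AddMonoidAlgebra.mapRingHom (Fin n → ℤ) σ f

/-- A Frobenius lift: a ring endomorphism with `σ r ≡ r^p mod p`. -/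
def IsFrobeniusLift (p : ℕ) (σ : R →+* R) : Prop := ∀ r : R, (p : R) ∣ σ r - r ^ p

/-- `U_f(μ)`: the elements `a` of the completion of `Ω_f(μ)` such that the `s`-th iterate of the
Cartier operator maps `a` into `p^s` times the completion of `Ω_{f^{σ^s}}(μ)`, for all `s ≥ 1`. -/
def U (p : ℕ) (σ : R →+* R) (f : Laurent R n) (b : Fin n → ℤ) (μ : Set (Fin n → ℝ)) :
    Set (Formal R n) :=
  {a | a ∈ OmegaHat p f b μ ∧ ∀ s : ℕ, 1 ≤ s →
    ∃ c ∈ OmegaHat p (twist (σ ^ s) f) b μ, (cartier p)^[s] a = (p : R) ^ s • c}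

/-- The condition defining `Λ_σ`: `C_p(ω_u) ≡ ∑_v Λ_{u,v} ω_v^σ mod U_{f^σ}(μ)`. -/
def IsLambda (p : ℕ) (σ : R →+* R) (f : Laurent R n) (b : Fin n → ℤ) (μ : Set (Fin n → ℝ))
    (Λ : Matrix (latticePoints f μ) (latticePoints f μ) R) : Prop :=
  ∀ u : latticePoints f μ, cartier p (omega f b u) -
      ∑ v : latticePoints f μ, Λ u v • omega (twist σ f) b v ∈ U p σ (twist σ f) b μ

/-- The condition defining `N_δ`: `δ(ω_u) ≡ ∑_v N_{u,v} ω_v mod U_f(μ)`, where `δ` acts on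
coefficients. -/
def IsN (p : ℕ) (σ : R →+* R) (δ : Derivation ℤ R R) (f : Laurent R n) (b : Fin n → ℤ)
    (μ : Set (Fin n → ℝ)) (N : Matrix (latticePoints f μ) (latticePoints f μ) R) : Prop :=
  ∀ u : latticePoints f μ, (fun w => δ (omega f b u w)) -
      ∑ v : latticePoints f μ, N u v • omega f b v ∈ U p σ f b μ

/-- The matrix `γ_m(μ)`, whose `(u,v)` entry is the constant term of
`(φ_v^m - (φ_v - f / x^v)^m) ω_u`. -/
def gamma (f : Laurent R n) (b : Fin n → ℤ) (μ : Set (Fin n → ℝ)) (φ : (Fin n → ℤ) → R) (m : ℕ) :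
    Matrix (latticePoints f μ) (latticePoints f μ) R :=
  fun u v => polyMul
    (AddMonoidAlgebra.single 0 (φ v) ^ m -
      (AddMonoidAlgebra.single 0 (φ v) - f * AddMonoidAlgebra.single (-(v : Fin n → ℤ)) 1) ^ m)
    (omega f b u) 0

/-- Entrywise congruence of matrices modulo `d`. -/
def MatCongr {ι : Type*} (d : R) (A B : Matrix ι ι R) : Prop := ∀ i j, d ∣ A i j - B i j

end DworkCrystal

end

/-! Everything is tested through the pairing `ct P a`, the constant term of a Laurent polynomial
times a series. Under it the Cartier operator is adjoint to x ↦ x^p (`ct_frob`), while A^(p^(s+1) m)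
is congruent modulo p^(s+1) to the (p^s m)-th power of A^σ evaluated at x^p. By induction, if
C_p^s(a) is divisible by p^s for all s, then p^s divides the constant term of A^(p^s m) a
(`IsFormallyExact.pow_dvd_ct_pow`). Elements of U have this property, so the functionals that define
γ_m vanish on U modulo p^ord(m). Applying them to the relations for C_p(ω_u) and δ(ω_u) gives both
families of congruences. For δ one also uses that m divides δ(A^m). For Λ the descent from m to m/p
loses one power of p, which is recovered because the error in C_p(ω_u) is p times an element of U,
not merely an element of U.

Existence rests on a contraction: C_p maps the completion of Ω_f into ∑ R ω_v^σ + p Ω̂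
(`Setting.cartier_mem`). On a generator, write f^p = f^σ(x^p) + pG, put f^(pm) with pm ≥ k in the
denominator, expand in powers of pG / f^σ(x^p), and apply C_p termwise. The factorials (k-1)! turn
the terms into multiples of generators, and every term of pole order above 1 keeps a factor p. The
matrix of C_p on leading terms is congruent to γ_p modulo p, hence invertible. Leading terms can
therefore be removed by successive approximation, so each element of the completion is a combination
of the ω_v plus an element of U (`Setting.exists_sub_mem_U`). The combination is unique: if ∑ c_u
ω_u is in U, then p^s divides c γ_(p^s), and γ_(p^s) is invertible, so p^s divides c for all s.

Rational functions are handled in a ring of Hahn series. A linear functional L with its unique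
minimum on the support at b orders the exponents, f becomes invertible, and the expansion at b is
the honest product g f^(-k) (`IsVertexUnit.expansion_eq`). -/

noncomputable section

namespace DworkCrystal

variable {R : Type*} [CommRing R] {n : ℕ}

/-! ### Laurent polynomials -/

/-- The substitution `x ↦ x^p` on Laurent polynomials. -/
def frob (p : ℕ) : Laurent R n →+* Laurent R n :=
  AddMonoidAlgebra.mapDomainRingHom R (zsmulAddGroupHom (p : ℤ) : (Fin n → ℤ) →+ (Fin n → ℤ))

theorem frob_single (p : ℕ) (u : Fin n → ℤ) (c : R) :
    frob p (AddMonoidAlgebra.single u c) = AddMonoidAlgebra.single ((p : ℤ) • u) c := by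
  simp [frob]

theorem twist_single (σ : R →+* R) (u : Fin n → ℤ) (c : R) :
    twist σ (AddMonoidAlgebra.single u c) = AddMonoidAlgebra.single u (σ c) := by
  simp [twist]

theorem twist_add (σ : R →+* R) (f g : Laurent R n) : twist σ (f + g) = twist σ f + twist σ g :=
  map_add _ _ _

theorem twist_sub (σ : R →+* R) (f g : Laurent R n) : twist σ (f - g) = twist σ f - twist σ g :=
  map_sub _ _ _

theorem twist_mul (σ : R →+* R) (f g : Laurent R n) : twist σ (f * g) = twist σ f * twist σ g :=
  map_mul _ _ _

theorem twist_pow (σ : R →+* R) (f : Laurent R n) (k : ℕ) : twist σ (f ^ k) = twist σ f ^ k :=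
  map_pow _ _ _

theorem coeff_twist (σ : R →+* R) (f : Laurent R n) (u : Fin n → ℤ) :
    (twist σ f).coeff u = σ (f.coeff u) := by
  induction f using AddMonoidAlgebra.induction_linear with
  | zero => simp [twist]
  | add f g hf hg => simp [twist_add, hf, hg]
  | single v c =>
    classical
    rw [twist_single]
    simp only [AddMonoidAlgebra.coeff_single, Finsupp.single_apply]
    split_ifs <;> simp

theorem twist_twist (σ τ : R →+* R) (f : Laurent R n) :
    twist σ (twist τ f) = twist (σ.comp τ) f := by
  ext u
  simp [coeff_twist]

theorem twist_one (f : Laurent R n) : twist (1 : R →+* R) f = f := by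
  ext u
  simp [coeff_twist]

theorem support_twist (σ : R →+* R) (f : Laurent R n) :
    (twist σ f).coeff.support ⊆ f.coeff.support := by
  intro u hu
  rw [Finsupp.mem_support_iff, coeff_twist] at hu
  rw [Finsupp.mem_support_iff]
  rintro h
  exact hu (by rw [h, map_zero])

/-- The p-th power map is additive modulo p, so only monomials matter, and for those this is the
definition of a Frobenius lift. -/
theorem natCast_dvd_pow_sub_frob_twist {p : ℕ} (hp : p.Prime) {σ : R →+* R}
    (hσ : IsFrobeniusLift p σ) (f : Laurent R n) :
    (p : Laurent R n) ∣ f ^ p - frob p (twist σ f) := by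
  induction f using AddMonoidAlgebra.induction_linear with
  | zero => simp [twist, hp.ne_zero]
  | add f g hf hg =>
    obtain ⟨r, hr⟩ := exists_add_pow_prime_eq hp f g
    rw [hr, twist_add, map_add]
    have : f ^ p + g ^ p + p * f * g * r - (frob p (twist σ f) + frob p (twist σ g)) =
      (f ^ p - frob p (twist σ f)) + (g ^ p - frob p (twist σ g)) + p * (f * g * r) := by ring
    rw [this]
    exact ((hf.add hg).add (dvd_mul_right _ _))
  | single v c =>
    rw [twist_single, frob_single, AddMonoidAlgebra.single_pow]
    obtain ⟨r, hr⟩ := hσ c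
    refine ⟨AddMonoidAlgebra.single ((p : ℤ) • v) (-r), ?_⟩
    have h1 : c ^ p = σ c + (p : R) * (-r) := by linear_combination -hr
    rw [h1, AddMonoidAlgebra.single_add, ← nsmul_eq_mul, ← nsmul_eq_mul,
      AddMonoidAlgebra.smul_single, natCast_zsmul, add_sub_cancel_left]

/-- Each further p-th power of a congruence modulo p gains one power of p. -/
theorem pow_dvd_pow_sub_frob_twist {p : ℕ} (hp : p.Prime) {σ : R →+* R}
    (hσ : IsFrobeniusLift p σ) (A : Laurent R n) (s m : ℕ) :
    (p : Laurent R n) ^ (s + 1) ∣ A ^ (p ^ (s + 1) * m) - frob p (twist σ (A ^ (p ^ s * m))) := by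
  have h := dvd_sub_pow_of_dvd_sub (natCast_dvd_pow_sub_frob_twist hp hσ A) s
  have h2 := h.trans (sub_dvd_pow_sub_pow _ _ m)
  rwa [← pow_mul, ← pow_mul, ← pow_mul, ← mul_assoc, ← pow_succ', ← map_pow, ← twist_pow] at h2

/-! ### Multiplication of a formal series by a Laurent polynomial -/

theorem polyMul_single (u : Fin n → ℤ) (c : R) (a : Formal R n) (w : Fin n → ℤ) :
    polyMul (AddMonoidAlgebra.single u c) a w = c * a (w - u) := by
  simp [polyMul]

theorem polyMul_zero_left (a : Formal R n) : polyMul 0 a = 0 := by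
  ext w; simp [polyMul]

theorem polyMul_add_left (P Q : Laurent R n) (a : Formal R n) :
    polyMul (P + Q) a = polyMul P a + polyMul Q a := by
  ext w
  simp only [polyMul, AddMonoidAlgebra.coeff_add, Pi.add_apply]
  exact Finsupp.sum_add_index' (by simp) (by intros; ring)

theorem polyMul_smul_left (r : R) (P : Laurent R n) (a : Formal R n) :
    polyMul (r • P) a = r • polyMul P a := by
  induction P using AddMonoidAlgebra.induction_linear with
  | zero => simp [polyMul_zero_left]
  | add f g hf hg => rw [smul_add, polyMul_add_left, hf, hg, polyMul_add_left, smul_add]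
  | single v c =>
    ext w
    rw [AddMonoidAlgebra.smul_single, Pi.smul_apply, polyMul_single, polyMul_single, smul_eq_mul,
      smul_eq_mul, mul_assoc]

theorem polyMul_sub_left (P Q : Laurent R n) (a : Formal R n) :
    polyMul (P - Q) a = polyMul P a - polyMul Q a := by
  rw [sub_eq_add_neg, ← neg_one_smul R Q, polyMul_add_left, polyMul_smul_left, neg_one_smul,
    ← sub_eq_add_neg]

/-- Multiplication by a fixed Laurent polynomial, as a linear map on formal series. -/
def polyMulLin (P : Laurent R n) : Formal R n →ₗ[R] Formal R n where
  toFun := polyMul P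
  map_add' a c := by
    ext w
    simp [polyMul, Finsupp.sum, mul_add, Finset.sum_add_distrib]
  map_smul' r a := by
    ext w
    simp only [polyMul, Finsupp.sum, Pi.smul_apply, smul_eq_mul, RingHom.id_apply,
      Finset.mul_sum]
    exact Finset.sum_congr rfl fun _ _ => by ring

/-- The constant term of the product of a Laurent polynomial and a formal series. -/
def ct (P : Laurent R n) : Formal R n →ₗ[R] R := LinearMap.proj 0 ∘ₗ polyMulLin P

theorem ct_apply (P : Laurent R n) (a : Formal R n) : ct P a = polyMul P a 0 := rfl

theorem ct_sub_left (P Q : Laurent R n) (a : Formal R n) : ct (P - Q) a = ct P a - ct Q a := by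
  simp [ct_apply, polyMul_sub_left]

theorem ct_add_left (P Q : Laurent R n) (a : Formal R n) : ct (P + Q) a = ct P a + ct Q a := by
  simp [ct_apply, polyMul_add_left]

theorem ct_smul_left (r : R) (P : Laurent R n) (a : Formal R n) : ct (r • P) a = r * ct P a := by
  simp [ct_apply, polyMul_smul_left]

theorem natCast_pow_dvd_ct {p s : ℕ} {P : Laurent R n} (h : (p : Laurent R n) ^ s ∣ P)
    (a : Formal R n) : (p : R) ^ s ∣ ct P a := by
  obtain ⟨Q, rfl⟩ := h
  have : (p : Laurent R n) ^ s * Q = ((p : R) ^ s) • Q := by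
    rw [Algebra.smul_def, map_pow, map_natCast]
  rw [this, ct_smul_left]
  exact dvd_mul_right _ _

/-! ### The Cartier operator -/

/-- The Cartier operator as a linear map. -/
def cartierLin (p : ℕ) : Formal R n →ₗ[R] Formal R n where
  toFun := cartier p
  map_add' _ _ := rfl
  map_smul' _ _ := rfl

theorem cartierLin_apply (p : ℕ) (a : Formal R n) : cartierLin p a = cartier p a := rfl

theorem cartier_iterate (p s : ℕ) (a : Formal R n) :
    (cartier p)^[s] a = (cartierLin p ^ s) a := by
  rw [Module.End.pow_apply]; rfl

/-- Adjointness: the constant term of P(x^p) a only sees the coefficients of a at exponents in pℤⁿ.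
-/
theorem ct_frob (p : ℕ) (P : Laurent R n) (a : Formal R n) :
    ct (frob p P) a = ct P (cartier p a) := by
  induction P using AddMonoidAlgebra.induction_linear with
  | zero => simp [ct_apply, polyMul_zero_left]
  | add f g hf hg => rw [map_add, ct_add_left, ct_add_left, hf, hg]
  | single v c => rw [frob_single, ct_apply, ct_apply, polyMul_single, polyMul_single]; simp [cartier]

/-- Formal series whose `s`-th Cartier iterate is divisible by `p^s`, for all `s`. -/
def IsFormallyExact (p : ℕ) (a : Formal R n) : Prop :=
  ∀ s : ℕ, ∃ c : Formal R n, (cartierLin p ^ s) a = (p : R) ^ s • c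

/-- The coefficients have no p-torsion, so one factor p can be cancelled from each higher Cartier
condition. This lets inductions on s pass from a to C_p(a)/p. -/
theorem IsFormallyExact.exists_cartier [IsDomain R] [CharZero R] {p : ℕ} (hp : p.Prime)
    {a : Formal R n} (ha : IsFormallyExact p a) :
    ∃ c, cartier p a = (p : R) • c ∧ IsFormallyExact p c := by
  obtain ⟨c, hc⟩ := ha 1
  rw [pow_one, pow_one, cartierLin_apply] at hc
  refine ⟨c, hc, fun s => ?_⟩
  obtain ⟨d, hd⟩ := ha (s + 1)
  refine ⟨d, ?_⟩
  rw [pow_succ, Module.End.mul_apply, cartierLin_apply, hc, map_smul, pow_succ', mul_smul] at hd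
  exact smul_right_injective _ (by exact_mod_cast hp.ne_zero) hd

theorem IsFormallyExact.sub {p : ℕ} {a c : Formal R n} (ha : IsFormallyExact p a)
    (hc : IsFormallyExact p c) : IsFormallyExact p (a - c) := by
  intro s
  obtain ⟨x, hx⟩ := ha s
  obtain ⟨y, hy⟩ := hc s
  exact ⟨x - y, by rw [map_sub, hx, hy, smul_sub]⟩

/-- On formally exact series the constant term against an `m`-th power is divisible by the
`p`-part of `m`. -/
theorem IsFormallyExact.pow_dvd_ct_pow [IsDomain R] [CharZero R] {p : ℕ} (hp : p.Prime)
    {σ : R →+* R} (hσ : IsFrobeniusLift p σ) (s m : ℕ) (A : Laurent R n) (a : Formal R n)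
    (ha : IsFormallyExact p a) : (p : R) ^ s ∣ ct (A ^ (p ^ s * m)) a := by
  induction s generalizing A a with
  | zero => simp
  | succ s ih =>
    obtain ⟨c, hc, hc'⟩ := ha.exists_cartier hp
    -- Adjointness turns the pairing of A with a into that of A^σ with C_p(a) = p c; the explicit p
    -- supplies the power missing from the induction hypothesis.
    have h1 := natCast_pow_dvd_ct (pow_dvd_pow_sub_frob_twist hp hσ A s m) a
    rw [ct_sub_left, ct_frob, hc, map_smul, twist_pow] at h1
    have h2 := mul_dvd_mul_left (p : R) (ih (twist σ A) c hc')
    rw [← pow_succ'] at h2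
    have := h1.add h2
    rwa [smul_eq_mul, sub_add_cancel] at this

/-! ### Derivations -/

/-- A derivation acting on the coefficients of a Laurent polynomial. -/
def coeffDer (δ : Derivation ℤ R R) : Laurent R n →+ Laurent R n where
  toFun P := .ofCoeff (P.coeff.mapRange δ (map_zero δ))
  map_zero' := by simp
  map_add' P Q := by
    ext u
    simp

theorem coeff_coeffDer (δ : Derivation ℤ R R) (P : Laurent R n) (u : Fin n → ℤ) :
    (coeffDer δ P).coeff u = δ (P.coeff u) := rfl

theorem coeffDer_single (δ : Derivation ℤ R R) (u : Fin n → ℤ) (c : R) :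
    coeffDer δ (AddMonoidAlgebra.single u c) = AddMonoidAlgebra.single u (δ c) := by
  ext v
  simp [coeff_coeffDer, AddMonoidAlgebra.coeff_single, Finsupp.single_apply]
  split_ifs <;> simp

theorem coeffDer_mul (δ : Derivation ℤ R R) (P Q : Laurent R n) :
    coeffDer δ (P * Q) = P * coeffDer δ Q + coeffDer δ P * Q := by
  induction P using AddMonoidAlgebra.induction_linear with
  | zero => simp
  | add f g hf hg => rw [add_mul, map_add, hf, hg, map_add]; ring
  | single v c =>
    induction Q using AddMonoidAlgebra.induction_linear with
    | zero => simp
    | add f g hf hg => rw [mul_add, map_add, hf, hg, map_add]; ring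
    | single u d =>
      simp only [coeffDer_single, AddMonoidAlgebra.single_mul_single, Derivation.leibniz,
        smul_eq_mul, AddMonoidAlgebra.single_add]
      rw [mul_comm d]

theorem natCast_dvd_coeffDer_pow (δ : Derivation ℤ R R) (P : Laurent R n) (m : ℕ) :
    (m : Laurent R n) ∣ coeffDer δ (P ^ m) := by
  suffices h : coeffDer δ (P ^ m) = m * P ^ (m - 1) * coeffDer δ P by
    rw [h, mul_assoc]; exact dvd_mul_right _ _
  induction m with
  | zero =>
    have h : (1 : Laurent R n) = AddMonoidAlgebra.single 0 1 := rfl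
    simp [h, coeffDer_single]
  | succ m ih =>
    rw [pow_succ, coeffDer_mul, ih]
    rcases m with _ | m
    · simp
    · push_cast; ring

theorem der_polyMul (δ : Derivation ℤ R R) (P : Laurent R n) (a : Formal R n) :
    (fun w => δ (polyMul P a w)) =
      polyMul (coeffDer δ P) a + polyMul P (fun w => δ (a w)) := by
  induction P using AddMonoidAlgebra.induction_linear with
  | zero => ext w; simp [polyMul_zero_left]
  | add f g hf hg =>
    ext w
    have h1 := congrFun hf w
    have h2 := congrFun hg w
    simp only [polyMul_add_left, map_add, Pi.add_apply] at h1 h2 ⊢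
    rw [h1, h2]; ring
  | single v c =>
    ext w
    simp only [coeffDer_single, Pi.add_apply, polyMul_single, Derivation.leibniz, smul_eq_mul]
    ring

/-! ### A ring of generalized series containing the rational functions -/

/-- Exponents `(L u, u)`, ordered first by the value of a functional `L`. -/
abbrev ExpGroup (n : ℕ) := ℝ ×ₗ Lex (Fin n → ℤ)

/-- Hahn series with exponents in `ExpGroup n`. -/
abbrev Hahn (R : Type*) [CommRing R] (n : ℕ) := HahnSeries (ExpGroup n) R

/-- The embedding of `ℤⁿ` into the ordered group of exponents. -/
def expHom (L : (Fin n → ℤ) →+ ℝ) : (Fin n → ℤ) →+ ExpGroup n where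
  toFun u := toLex (L u, toLex u)
  map_zero' := by rw [map_zero]; rfl
  map_add' u v := by rw [map_add]; rfl

theorem expHom_apply (L : (Fin n → ℤ) →+ ℝ) (u : Fin n → ℤ) :
    expHom L u = toLex (L u, toLex u) := rfl

/-- L may fail to be injective on ℤⁿ; the second lexicographic coordinate keeps the exponent itself.
-/
theorem expHom_injective (L : (Fin n → ℤ) →+ ℝ) : Function.Injective (expHom L) := by
  intro u v h
  exact congrArg (fun x : ExpGroup n => ofLex (ofLex x).2) h

/-- Laurent polynomials as Hahn series. -/
def toHahn (L : (Fin n → ℤ) →+ ℝ) : Laurent R n →ₐ[R] Hahn R n :=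
  AddMonoidAlgebra.lift R (Hahn R n) (Fin n → ℤ)
    { toFun := fun u => HahnSeries.single (expHom L u.toAdd) 1
      map_one' := by simp
      map_mul' := fun u v => by simp [HahnSeries.single_mul_single] }

theorem toHahn_single (L : (Fin n → ℤ) →+ ℝ) (u : Fin n → ℤ) (c : R) :
    toHahn L (AddMonoidAlgebra.single u c) = HahnSeries.single (expHom L u) c := by
  rw [toHahn, AddMonoidAlgebra.lift_single]
  exact (HahnSeries.single_zero_mul_eq_smul (r := c)).symm.trans (by
    simp [HahnSeries.single_mul_single])

/-- The formal Laurent series of a Hahn series. -/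
def toFormal (L : (Fin n → ℤ) →+ ℝ) : Hahn R n →ₗ[R] Formal R n where
  toFun a := fun w => a.coeff (expHom L w)
  map_add' _ _ := rfl
  map_smul' _ _ := rfl

theorem toFormal_apply (L : (Fin n → ℤ) →+ ℝ) (a : Hahn R n) (w : Fin n → ℤ) :
    toFormal L a w = a.coeff (expHom L w) := rfl

theorem toFormal_toHahn_mul (L : (Fin n → ℤ) →+ ℝ) (P : Laurent R n) (a : Hahn R n) :
    toFormal L (toHahn L P * a) = polyMul P (toFormal L a) := by
  induction P using AddMonoidAlgebra.induction_linear with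
  | zero => simp [polyMul_zero_left]
  | add f g hf hg => rw [map_add, add_mul, map_add, hf, hg, polyMul_add_left]
  | single v c =>
    ext w
    rw [toHahn_single, polyMul_single, toFormal_apply, toFormal_apply, HahnSeries.coeff_single_mul,
      map_sub]

theorem toFormal_intCast_mul (L : (Fin n → ℤ) →+ ℝ) (z : ℤ) (a : Hahn R n) (w : Fin n → ℤ) :
    toFormal L ((z : Hahn R n) * a) w = (z : R) * toFormal L a w := by
  rw [← zsmul_eq_mul, map_zsmul, Pi.smul_apply, zsmul_eq_mul]

theorem toFormal_toHahn (L : (Fin n → ℤ) →+ ℝ) (P : Laurent R n) :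
    toFormal L (toHahn L P) = P.coeff := by
  induction P using AddMonoidAlgebra.induction_linear with
  | zero => simp
  | add f g hf hg => rw [map_add, map_add, hf, hg]; rfl
  | single v c =>
    ext w
    classical
    rw [toHahn_single, toFormal_apply, AddMonoidAlgebra.coeff_single, HahnSeries.coeff_single,
      Finsupp.single_apply]
    simp only [(expHom_injective L).eq_iff, eq_comm]

theorem coeff_toHahn (L : (Fin n → ℤ) →+ ℝ) (P : Laurent R n) (u : Fin n → ℤ) :
    (toHahn L P).coeff (expHom L u) = P.coeff u :=
  congrFun (toFormal_toHahn L P) u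

theorem exists_of_coeff_toHahn_ne_zero (L : (Fin n → ℤ) →+ ℝ) (P : Laurent R n) (γ : ExpGroup n)
    (h : (toHahn L P).coeff γ ≠ 0) : ∃ u, γ = expHom L u := by
  induction P using AddMonoidAlgebra.induction_linear with
  | zero => simp at h
  | add f g hf hg =>
    by_cases hf0 : (toHahn L f).coeff γ = 0
    · refine hg fun hg0 => h ?_
      rw [map_add, HahnSeries.coeff_add, hf0, hg0, add_zero]
    · exact hf hf0
  | single v c =>
    rw [toHahn_single] at h
    exact ⟨v, by_contra fun hv => h (HahnSeries.coeff_single_of_ne hv)⟩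

/-! ### Lower bounds for exponents -/

/-- All exponents of `a` have first component at least `c`. -/
def LowerBound (a : Hahn R n) (c : ℝ) : Prop :=
  ∀ γ : ExpGroup n, a.coeff γ ≠ 0 → c ≤ (ofLex γ).1

theorem LowerBound.mul {a b : Hahn R n} {c d : ℝ} (ha : LowerBound a c) (hb : LowerBound b d) :
    LowerBound (a * b) (c + d) := by
  intro γ hγ
  obtain ⟨x, hx, y, hy, rfl⟩ := Set.mem_add.1 (HahnSeries.support_mul_subset hγ)
  exact add_le_add (ha x hx) (hb y hy)

theorem LowerBound.pow {a : Hahn R n} {c : ℝ} (ha : LowerBound a c) (k : ℕ) :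
    LowerBound (a ^ k) (k * c) := by
  induction k with
  | zero =>
    intro γ hγ
    rw [pow_zero, HahnSeries.coeff_one] at hγ
    have : γ = 0 := by by_contra h; simp [h] at hγ
    rw [this]; simp
  | succ k ih =>
    rw [pow_succ]
    convert ih.mul ha using 1
    push_cast; ring

/-- Series without exponents of negative first component. -/
def nonnegSubring (R : Type*) [CommRing R] (n : ℕ) : Subring (Hahn R n) where
  carrier := {a | LowerBound a 0}
  mul_mem' ha hb := by simpa using ha.mul hb
  one_mem' := by
    have h : LowerBound (0 : Hahn R n) 0 := fun γ hγ => absurd HahnSeries.coeff_zero hγ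
    simpa using h.pow 0
  add_mem' {a b} ha hb γ hγ := by
    by_cases h : a.coeff γ = 0
    · exact hb γ fun h' => hγ (by rw [HahnSeries.coeff_add, h, h', add_zero])
    · exact ha γ h
  zero_mem' := fun γ hγ => absurd HahnSeries.coeff_zero hγ
  neg_mem' {a} ha γ hγ := ha γ fun h => hγ (by rw [HahnSeries.coeff_neg, h, neg_zero])

theorem exists_lowerBound (a : Hahn R n) : ∃ c, LowerBound a c := by
  refine ⟨(ofLex a.order).1, fun γ hγ => ?_⟩
  have h := HahnSeries.order_le_of_coeff_ne_zero hγ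
  rcases Prod.Lex.le_iff.1 h with h | h
  · exact h.le
  · exact h.1.le

theorem exists_pos_lowerBound {L : (Fin n → ℤ) →+ ℝ} {h : Laurent R n}
    (hh : ∀ u, h.coeff u ≠ 0 → 0 < L u) : ∃ ε : ℝ, 0 < ε ∧ LowerBound (toHahn L h) ε := by
  classical
  -- The element 1 is inserted so that the minimum exists and is positive even when h = 0.
  have hne : (insert 1 (h.coeff.support.image L)).Nonempty := Finset.insert_nonempty _ _
  refine ⟨(insert 1 (h.coeff.support.image L)).min' hne, ?_, ?_⟩
  · rw [Finset.lt_min'_iff]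
    intro y hy
    rcases Finset.mem_insert.1 hy with rfl | hy
    · exact one_pos
    · obtain ⟨u, hu, rfl⟩ := Finset.mem_image.1 hy
      exact hh u (Finsupp.mem_support_iff.1 hu)
  · intro γ hγ
    obtain ⟨u, rfl⟩ := exists_of_coeff_toHahn_ne_zero L h γ hγ
    rw [coeff_toHahn] at hγ
    exact Finset.min'_le _ _ (Finset.mem_insert_of_mem
      (Finset.mem_image_of_mem _ (Finsupp.mem_support_iff.2 hγ)))

/-! ### Inverting a polynomial with a unit coefficient at a vertex -/

/-- The coefficient at `b` is a unit, and `b` is the unique minimum of `L` on the support. -/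
structure IsVertexUnit (L : (Fin n → ℤ) →+ ℝ) (b : Fin n → ℤ) (f : Laurent R n) : Prop where
  unit : IsUnit (f.coeff b)
  lt : ∀ u, f.coeff u ≠ 0 → u ≠ b → L b < L u

/-- The polynomial `h` in the factorization `f = f_b x^b (1 + h)`. -/
def tailPoly (f : Laurent R n) (b : Fin n → ℤ) : Laurent R n :=
  AddMonoidAlgebra.single (-b) (Ring.inverse (f.coeff b)) * f - 1

theorem IsVertexUnit.tail_pos {L : (Fin n → ℤ) →+ ℝ} {b : Fin n → ℤ} {f : Laurent R n}
    (hf : IsVertexUnit L b f) (u : Fin n → ℤ) (hu : (tailPoly f b).coeff u ≠ 0) : 0 < L u := by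
  classical
  have h1 : (tailPoly f b).coeff u =
      Ring.inverse (f.coeff b) * f.coeff (b + u) - if 0 = u then 1 else 0 := by
    rw [tailPoly, AddMonoidAlgebra.coeff_sub, Finsupp.sub_apply,
      AddMonoidAlgebra.coeff_single_mul_apply, neg_neg, AddMonoidAlgebra.one_def,
      AddMonoidAlgebra.coeff_single, Finsupp.single_apply]
  rw [h1] at hu
  have hu0 : u ≠ 0 := by
    rintro rfl
    rw [add_zero, Ring.inverse_mul_cancel _ hf.unit, if_pos rfl, sub_self] at hu
    exact hu rfl
  have h2 : f.coeff (b + u) ≠ 0 := by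
    intro h
    rw [h, mul_zero, if_neg (Ne.symm hu0), sub_zero] at hu
    exact hu rfl
  have := hf.lt _ h2 (by simpa using hu0)
  rw [map_add] at this
  linarith

theorem isUnit_one_add_toHahn {L : (Fin n → ℤ) →+ ℝ} {h : Laurent R n}
    (hh : ∀ u, h.coeff u ≠ 0 → 0 < L u) : IsUnit (1 + toHahn L h) := by
  apply HahnSeries.isUnit_of_orderTop_pos
  rw [add_sub_cancel_left]
  by_cases h0 : toHahn L h = 0
  · rw [h0, HahnSeries.orderTop_zero]; exact WithTop.coe_lt_top 0
  rw [HahnSeries.zero_lt_orderTop_iff h0]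
  have h1 : (toHahn L h).coeff (toHahn L h).order ≠ 0 := fun h' =>
    h0 (HahnSeries.coeff_order_eq_zero.1 h')
  obtain ⟨u, hu⟩ := exists_of_coeff_toHahn_ne_zero L h _ h1
  rw [hu, coeff_toHahn] at h1
  rw [hu, Prod.Lex.lt_iff]
  exact Or.inl (hh u h1)

theorem toHahn_eq_single_mul {L : (Fin n → ℤ) →+ ℝ} {b : Fin n → ℤ} {f : Laurent R n}
    (hf : IsUnit (f.coeff b)) :
    toHahn L f = HahnSeries.single (expHom L b) (f.coeff b) * (1 + toHahn L (tailPoly f b)) := by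
  rw [tailPoly, map_sub, map_one, add_sub_cancel, map_mul, toHahn_single, ← mul_assoc,
    HahnSeries.single_mul_single, Ring.mul_inverse_cancel _ hf, map_neg, add_neg_cancel]
  simp

theorem IsVertexUnit.isUnit_toHahn {L : (Fin n → ℤ) →+ ℝ} {b : Fin n → ℤ} {f : Laurent R n}
    (hf : IsVertexUnit L b f) : IsUnit (toHahn L f) := by
  rw [toHahn_eq_single_mul hf.unit]
  refine IsUnit.mul ?_ (isUnit_one_add_toHahn hf.tail_pos)
  refine IsUnit.of_mul_eq_one (HahnSeries.single (expHom L (-b)) (Ring.inverse (f.coeff b))) ?_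
  rw [HahnSeries.single_mul_single, Ring.mul_inverse_cancel _ hf.unit, map_neg, add_neg_cancel]
  rfl

/-- The inverse of a Laurent polynomial in the ring of Hahn series. -/
def invHahn (L : (Fin n → ℤ) →+ ℝ) (f : Laurent R n) : Hahn R n := Ring.inverse (toHahn L f)

theorem IsVertexUnit.mul_invHahn {L : (Fin n → ℤ) →+ ℝ} {b : Fin n → ℤ} {f : Laurent R n}
    (hf : IsVertexUnit L b f) : toHahn L f * invHahn L f = 1 :=
  Ring.mul_inverse_cancel _ hf.isUnit_toHahn

/-! ### The truncated binomial series -/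

/-- The truncation of `(1 + y)^{-k}` to `N` terms. -/
def binomTrunc {A : Type*} [CommRing A] (k N : ℕ) (y : A) : A :=
  ∑ r ∈ Finset.range N, ((Ring.choose (-(k : ℤ)) r : ℤ) : A) * y ^ r

/-- Pascal's rule for binomials with negative upper entry: multiplication by 1 + y lowers k by one
and leaves only a boundary term. -/
theorem one_add_mul_binomTrunc {A : Type*} [CommRing A] (k N : ℕ) (y : A) :
    (1 + y) * binomTrunc (k + 1) (N + 1) y =
      binomTrunc k (N + 1) y + ((Ring.choose (-((k + 1 : ℕ) : ℤ)) N : ℤ) : A) * y ^ (N + 1) := by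
  induction N with
  | zero => simp [binomTrunc]
  | succ N ih =>
    have h := Ring.choose_succ_succ (-((k + 1 : ℕ) : ℤ)) N
    have h' : (-((k + 1 : ℕ) : ℤ)) + 1 = -(k : ℤ) := by push_cast; ring
    rw [h'] at h
    rw [binomTrunc, Finset.sum_range_succ, ← binomTrunc, mul_add, ih]
    conv_rhs => rw [binomTrunc, Finset.sum_range_succ, ← binomTrunc, h]
    push_cast
    ring

/-- The error is kept in the form y^N Q with Q a polynomial in y, so that for y of positive order it
moves out to arbitrarily large exponents as N grows. -/
theorem exists_pow_mul_binomTrunc {A : Type*} [CommRing A] (k N : ℕ) (hN : 1 ≤ N) (y : A) :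
    ∃ Q ∈ Subring.closure {y}, (1 + y) ^ k * binomTrunc k N y = 1 + y ^ N * Q := by
  obtain ⟨N, rfl⟩ : ∃ M, N = M + 1 := ⟨N - 1, by omega⟩
  induction k with
  | zero =>
    refine ⟨0, zero_mem _, ?_⟩
    rw [binomTrunc, Finset.sum_range_succ']
    simp [Ring.choose_zero_succ]
  | succ k ih =>
    obtain ⟨Q, hQS, hQ⟩ := ih
    have hy : y ∈ Subring.closure {y} := Subring.subset_closure rfl
    refine ⟨Q + (1 + y) ^ k * ((Ring.choose (-((k + 1 : ℕ) : ℤ)) N : ℤ) : A),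
      add_mem hQS (mul_mem (pow_mem (add_mem (one_mem _) hy) k) (intCast_mem _ _)), ?_⟩
    rw [pow_succ, mul_assoc, one_add_mul_binomTrunc, mul_add, hQ]
    ring

/-! ### The expansion of `g / f^k` -/

/-- At a fixed exponent both sides agree with a long enough binomial truncation: each factor of the
tail h raises the value of L by at least ε > 0, so high powers of h contribute nothing there. -/
theorem IsVertexUnit.expansion_eq {L : (Fin n → ℤ) →+ ℝ} {b : Fin n → ℤ} {f : Laurent R n}
    (hf : IsVertexUnit L b f) (g : Laurent R n) (k : ℕ) :
    expansion f b g k = toFormal L (toHahn L g * invHahn L f ^ k) := by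
  ext w
  set h := tailPoly f b with hh
  set c := Ring.inverse (f.coeff b) with hc
  set y := toHahn L h with hy
  obtain ⟨ε, hε, hLB⟩ := exists_pos_lowerBound hf.tail_pos
  obtain ⟨x, hx⟩ := isUnit_one_add_toHahn hf.tail_pos
  have hxx : (1 + y) * (↑x⁻¹ : Hahn R n) = 1 := by rw [hy, hh, ← hx]; exact x.mul_inv
  have hsingle : HahnSeries.single (expHom L b) (f.coeff b) *
      HahnSeries.single (expHom L (-b)) c = (1 : Hahn R n) := by
    rw [HahnSeries.single_mul_single, hc, Ring.mul_inverse_cancel _ hf.unit, map_neg,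
      add_neg_cancel]
    rfl
  have hinv : invHahn L f = HahnSeries.single (expHom L (-b)) c * (↑x⁻¹ : Hahn R n) := by
    have h1 : toHahn L f * (HahnSeries.single (expHom L (-b)) c * (↑x⁻¹ : Hahn R n)) = 1 := by
      rw [toHahn_eq_single_mul hf.unit]
      linear_combination (1 + y) * (↑x⁻¹ : Hahn R n) * hsingle + hxx
    linear_combination (-invHahn L f) * h1 +
      HahnSeries.single (expHom L (-b)) c * (↑x⁻¹ : Hahn R n) * hf.mul_invHahn
  obtain ⟨e, he⟩ := exists_lowerBound (toHahn L g)
  obtain ⟨e', he'⟩ := exists_lowerBound ((↑x⁻¹ : Hahn R n) ^ k)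
  -- Beyond N₁ the terms of the defining sum vanish at w; beyond N₂ below, so does the truncation
  -- error.
  obtain ⟨N₁, hN₁⟩ := exists_nat_gt ((L (w + (k : ℤ) • b) - e) / ε)
  have hterm : ∀ r, N₁ ≤ r → (g * h ^ r).coeff (w + (k : ℤ) • b) = 0 := by
    intro r hr
    by_contra hne
    rw [← coeff_toHahn L, map_mul, map_pow] at hne
    have h1 := he.mul (hLB.pow r) _ hne
    rw [div_lt_iff₀ hε] at hN₁
    have h2 : (N₁ : ℝ) * ε ≤ r * ε := by gcongr
    simp only [expHom_apply, ofLex_toLex] at h1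
    linarith
  have hfin : ∀ N, N₁ ≤ N → expansion f b g k w =
      c ^ k * toFormal L (toHahn L g * binomTrunc k N y) (w + (k : ℤ) • b) := by
    intro N hN
    rw [expansion, finsum_eq_sum_of_support_subset (s := Finset.range N)]
    · rw [binomTrunc, Finset.mul_sum, map_sum, Finset.sum_apply, Finset.mul_sum]
      refine Finset.sum_congr rfl fun r _ => ?_
      rw [← hc, show AddMonoidAlgebra.single (-b) c * f - 1 = h from rfl, mul_assoc,
        mul_left_comm (toHahn L g), ← coeff_toHahn L, ← toFormal_apply, map_mul, map_pow,
        toFormal_intCast_mul]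
    · intro r hr
      by_contra hrN
      apply hr
      rw [← hc]
      simp only
      rw [show AddMonoidAlgebra.single (-b) c * f - 1 = h from rfl, hterm r, mul_zero]
      simp at hrN; omega
  obtain ⟨N₂, hN₂⟩ := exists_nat_gt ((L (w + (k : ℤ) • b) - e - e') / ε)
  obtain ⟨Q, hQS, hQ⟩ := exists_pow_mul_binomTrunc k (N₁ + N₂ + 1) (by omega) y
  have hQ0 : LowerBound Q 0 := by
    refine (Subring.closure_le (t := nonnegSubring R n)).2 ?_ hQS
    rw [Set.singleton_subset_iff]
    exact fun γ hγ => hε.le.trans (hLB γ hγ)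
  have hxk : (1 + y) ^ k * (↑x⁻¹ : Hahn R n) ^ k = 1 := by rw [← mul_pow, hxx, one_pow]
  have hB : toHahn L g * binomTrunc k (N₁ + N₂ + 1) y = toHahn L g * (↑x⁻¹ : Hahn R n) ^ k +
      toHahn L g * (↑x⁻¹ : Hahn R n) ^ k * y ^ (N₁ + N₂ + 1) * Q := by
    linear_combination (-toHahn L g * binomTrunc k (N₁ + N₂ + 1) y) * hxk +
      toHahn L g * (↑x⁻¹ : Hahn R n) ^ k * hQ
  have hzero : toFormal L (toHahn L g * (↑x⁻¹ : Hahn R n) ^ k * y ^ (N₁ + N₂ + 1) * Q)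
      (w + (k : ℤ) • b) = 0 := by
    by_contra hne
    have h1 := (((he.mul he').mul (hLB.pow (N₁ + N₂ + 1))).mul hQ0) _ hne
    rw [div_lt_iff₀ hε] at hN₂
    have h2 : (N₂ : ℝ) * ε ≤ (N₁ + N₂ + 1 : ℕ) * ε := by gcongr; omega
    simp only [expHom_apply, ofLex_toLex] at h1
    linarith
  rw [hfin (N₁ + N₂ + 1) (by omega), hB, map_add, Pi.add_apply, hzero, add_zero, hinv, mul_pow,
    mul_left_comm, ← toHahn_single, ← map_pow, AddMonoidAlgebra.single_pow, toHahn_single,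
    toFormal_apply, toFormal_apply, HahnSeries.coeff_single_mul, ← map_sub, smul_neg,
    sub_neg_eq_add, natCast_zsmul]

/-! ### The Cartier operator on rational functions -/

theorem zsmul_natCast_injective {p : ℕ} (hp : p ≠ 0) :
    Function.Injective fun u : Fin n → ℤ => (p : ℤ) • u :=
  smul_right_injective _ (by exact_mod_cast hp)

theorem coeff_frob {p : ℕ} (hp : p ≠ 0) (P : Laurent R n) (u : Fin n → ℤ) :
    (frob p P).coeff ((p : ℤ) • u) = P.coeff u := by
  classical
  induction P using AddMonoidAlgebra.induction_linear with
  | zero => simp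
  | add f g hf hg => rw [map_add, AddMonoidAlgebra.coeff_add, Finsupp.add_apply, hf, hg]; rfl
  | single v c =>
    rw [frob_single, AddMonoidAlgebra.coeff_single, AddMonoidAlgebra.coeff_single,
      Finsupp.single_apply, Finsupp.single_apply]
    simp only [(zsmul_natCast_injective hp).eq_iff]

theorem exists_of_coeff_frob_ne_zero {p : ℕ} (P : Laurent R n) (u : Fin n → ℤ)
    (h : (frob p P).coeff u ≠ 0) : ∃ v, u = (p : ℤ) • v := by
  classical
  induction P using AddMonoidAlgebra.induction_linear with
  | zero => simp at h
  | add f g hf hg =>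
    by_cases hf0 : (frob p f).coeff u = 0
    · refine hg fun hg0 => h ?_
      rw [map_add, AddMonoidAlgebra.coeff_add, Finsupp.add_apply, hf0, hg0, add_zero]
    · exact hf hf0
  | single v c =>
    rw [frob_single, AddMonoidAlgebra.coeff_single, Finsupp.single_apply] at h
    exact ⟨v, by_contra fun hv => h (if_neg (Ne.symm hv))⟩

theorem IsVertexUnit.frob {L : (Fin n → ℤ) →+ ℝ} {b : Fin n → ℤ} {f : Laurent R n}
    (hf : IsVertexUnit L b f) {p : ℕ} (hp : p ≠ 0) :
    IsVertexUnit L ((p : ℤ) • b) (frob p f) where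
  unit := by rw [coeff_frob hp]; exact hf.unit
  lt u hu hub := by
    obtain ⟨v, rfl⟩ := exists_of_coeff_frob_ne_zero f u hu
    rw [coeff_frob hp] at hu
    have h1 := hf.lt v hu (by rintro rfl; exact hub rfl)
    have h2 : (0 : ℝ) < p := by exact_mod_cast Nat.pos_of_ne_zero hp
    rw [map_zsmul, map_zsmul, zsmul_eq_mul, zsmul_eq_mul, Int.cast_natCast]
    exact mul_lt_mul_of_pos_left h1 h2

theorem IsVertexUnit.twist {L : (Fin n → ℤ) →+ ℝ} {b : Fin n → ℤ} {f : Laurent R n}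
    (hf : IsVertexUnit L b f) (σ : R →+* R) : IsVertexUnit L b (twist σ f) where
  unit := by rw [coeff_twist]; exact hf.unit.map σ
  lt u hu hub := hf.lt u (by rintro h; exact hu (by rw [coeff_twist, h, map_zero])) hub

/-- The Cartier operator on Laurent polynomials. -/
def cartierPoly (p : ℕ) (hp : p ≠ 0) (P : Laurent R n) : Laurent R n :=
  .ofCoeff (P.coeff.comapDomain (fun u => (p : ℤ) • u) (zsmul_natCast_injective hp).injOn)

theorem coeff_cartierPoly {p : ℕ} (hp : p ≠ 0) (P : Laurent R n) (u : Fin n → ℤ) :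
    (cartierPoly p hp P).coeff u = P.coeff ((p : ℤ) • u) := rfl

/-- The Cartier operator on Hahn series. -/
def cartierHahn (p : ℕ) (hp : p ≠ 0) (a : Hahn R n) : Hahn R n where
  coeff γ := a.coeff (p • γ)
  isPWO_support' := by
    -- Multiplication by p preserves and reflects the order of exponents, so partial well-ordering
    -- pulls back.
    intro f
    obtain ⟨i, j, hij, h⟩ := a.isPWO_support' fun i => ⟨p • (f i).1, (f i).2⟩
    exact ⟨i, j, hij, (nsmul_le_nsmul_iff_right hp).1 h⟩

theorem coeff_cartierHahn {p : ℕ} (hp : p ≠ 0) (a : Hahn R n) (γ : ExpGroup n) :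
    (cartierHahn p hp a).coeff γ = a.coeff (p • γ) := rfl

theorem toFormal_cartierHahn {p : ℕ} (hp : p ≠ 0) (L : (Fin n → ℤ) →+ ℝ) (a : Hahn R n) :
    toFormal L (cartierHahn p hp a) = cartier p (toFormal L a) := by
  ext w
  rw [toFormal_apply, coeff_cartierHahn, cartier, toFormal_apply, ← map_nsmul, natCast_zsmul]

/-- The projection formula: factors in x^p pass through the Cartier operator. -/
theorem cartierHahn_frob_mul {p : ℕ} (hp : p ≠ 0) (L : (Fin n → ℤ) →+ ℝ) (P : Laurent R n)
    (a : Hahn R n) :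
    cartierHahn p hp (toHahn L (frob p P) * a) = toHahn L P * cartierHahn p hp a := by
  induction P using AddMonoidAlgebra.induction_linear with
  | zero => ext γ; simp [coeff_cartierHahn]
  | add f g hf hg =>
    rw [map_add, map_add, map_add, add_mul, add_mul, ← hf, ← hg]
    ext γ
    simp [coeff_cartierHahn]
  | single v c =>
    ext γ
    rw [frob_single, toHahn_single, toHahn_single, coeff_cartierHahn, HahnSeries.coeff_single_mul,
      HahnSeries.coeff_single_mul, coeff_cartierHahn, natCast_zsmul, map_nsmul]
    congr 2
    exact (nsmul_sub _ _ _).symm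

theorem cartierHahn_toHahn {p : ℕ} (hp : p ≠ 0) (L : (Fin n → ℤ) →+ ℝ) (P : Laurent R n) :
    cartierHahn p hp (toHahn L P) = toHahn L (cartierPoly p hp P) := by
  have key : ∀ u, (cartierHahn p hp (toHahn L P)).coeff (expHom L u) =
      (toHahn L (cartierPoly p hp P)).coeff (expHom L u) := by
    intro u
    rw [coeff_toHahn, coeff_cartierPoly, coeff_cartierHahn, ← map_nsmul, coeff_toHahn,
      natCast_zsmul]
  ext γ
  by_cases h : ∃ u, γ = expHom L u
  · obtain ⟨u, rfl⟩ := h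
    exact key u
  -- Exponents off the graph of L: if pγ lies on the graph then so does γ, because L is additive and
  -- ℝ has no p-torsion.
  · rw [by_contra fun h' => h (exists_of_coeff_toHahn_ne_zero L (cartierPoly p hp P) γ h')]
    by_contra hne
    rw [coeff_cartierHahn] at hne
    obtain ⟨u, hu⟩ := exists_of_coeff_toHahn_ne_zero L P _ hne
    have h1 : p • (ofLex γ).1 = L u := congrArg (fun x : ExpGroup n => (ofLex x).1) hu
    have h2 : p • ofLex (ofLex γ).2 = u := congrArg (fun x : ExpGroup n => ofLex (ofLex x).2) hu
    refine h ⟨ofLex (ofLex γ).2, ?_⟩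
    rw [← h2, map_nsmul, nsmul_eq_mul, nsmul_eq_mul] at h1
    have h3 : (ofLex γ).1 = L (ofLex (ofLex γ).2) :=
      mul_left_cancel₀ (by exact_mod_cast hp : (p : ℝ) ≠ 0) h1
    rw [expHom_apply, ← h3]
    rfl

/-- Clear the denominator f(x^p)^j, apply the projection formula, and divide by f^j again. -/
theorem cartier_frob_denominator {p : ℕ} (hp : p ≠ 0) {L : (Fin n → ℤ) →+ ℝ} {b : Fin n → ℤ}
    {f : Laurent R n} (hf : IsVertexUnit L b f) (q : Laurent R n) (j : ℕ) :
    cartier p (toFormal L (toHahn L q * invHahn L (frob p f) ^ j)) =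
      expansion f b (cartierPoly p hp q) j := by
  rw [hf.expansion_eq, ← toFormal_cartierHahn hp]
  congr 1
  have h1 : toHahn L (frob p (f ^ j)) * (toHahn L q * invHahn L (frob p f) ^ j) = toHahn L q := by
    rw [map_pow, map_pow, mul_left_comm, ← mul_pow, (hf.frob hp).mul_invHahn, one_pow, mul_one]
  have h2 := congrArg (cartierHahn p hp) h1
  rw [cartierHahn_frob_mul, cartierHahn_toHahn, map_pow] at h2
  have h3 : toHahn L f ^ j * invHahn L f ^ j = 1 := by rw [← mul_pow, hf.mul_invHahn, one_pow]
  linear_combination (invHahn L f ^ j) * h2 -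
    cartierHahn p hp (toHahn L q * invHahn L (frob p f) ^ j) * h3

/-- Write F^(-k) = F^(pm-k) (F^p)^(-m) with F^p = H(1 + cG/H) and expand binomially, with a
remainder divisible by c^s. It is applied with F = f, H = f^σ(x^p) and c = p. -/
theorem exists_inverse_pow_eq {A : Type*} [CommRing A] {F Fi H Hi c G : A} {p k m s : ℕ}
    (hF : F * Fi = 1) (hH : H * Hi = 1) (hFp : F ^ p = H + c * G) (hkm : k ≤ p * m)
    (hs : 1 ≤ s) :
    ∃ Q : A, Fi ^ k = ∑ r ∈ Finset.range s, ((Ring.choose (-(m : ℤ)) r : ℤ) : A) * c ^ r *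
      (F ^ (p * m - k) * G ^ r * Hi ^ (m + r)) + c ^ s * Q := by
  obtain ⟨Q, -, hQ⟩ := exists_pow_mul_binomTrunc m s hs (c * G * Hi)
  have hFp' : F ^ p = H * (1 + c * G * Hi) := by
    rw [hFp]
    linear_combination (-(c * G)) * hH
  have hFm : F ^ (p * m) = H ^ m * (1 + c * G * Hi) ^ m := by rw [pow_mul, hFp', mul_pow]
  have hFim : F ^ (p * m) * Fi ^ (p * m) = 1 := by rw [← mul_pow, hF, one_pow]
  have hHim : H ^ m * Hi ^ m = 1 := by rw [← mul_pow, hH, one_pow]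
  obtain ⟨d, hd⟩ := Nat.exists_eq_add_of_le hkm
  have hFd : F ^ d * Fi ^ d = 1 := by rw [← mul_pow, hF, one_pow]
  have hk : Fi ^ k = F ^ d * Fi ^ (p * m) := by
    rw [hd, pow_add]
    linear_combination (-Fi ^ k) * hFd
  have h1 : F ^ (p * m) * (Hi ^ m * binomTrunc m s (c * G * Hi)) = 1 + (c * G * Hi) ^ s * Q := by
    rw [hFm, ← hQ]
    linear_combination (1 + c * G * Hi) ^ m * binomTrunc m s (c * G * Hi) * hHim
  refine ⟨-(F ^ d * Fi ^ (p * m) * (G * Hi) ^ s * Q), ?_⟩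
  have h2 : ∑ r ∈ Finset.range s, ((Ring.choose (-(m : ℤ)) r : ℤ) : A) * c ^ r *
      (F ^ (p * m - k) * G ^ r * Hi ^ (m + r)) = F ^ d * (Hi ^ m * binomTrunc m s (c * G * Hi)) := by
    rw [hd, Nat.add_sub_cancel_left, binomTrunc, Finset.mul_sum, Finset.mul_sum]
    refine Finset.sum_congr rfl fun r _ => ?_
    rw [pow_add]
    ring
  rw [h2, hk]
  have h3 : (c * G * Hi) ^ s = c ^ s * (G * Hi) ^ s := by rw [mul_assoc, mul_pow]
  rw [h3] at h1
  linear_combination (F ^ d * Hi ^ m * binomTrunc m s (c * G * Hi)) * hFim -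
    F ^ d * Fi ^ (p * m) * h1

theorem cartier_expansion {p : ℕ} (hp : p ≠ 0) {L : (Fin n → ℤ) →+ ℝ} {b : Fin n → ℤ}
    {f f' G : Laurent R n} (hf : IsVertexUnit L b f) (hf' : IsVertexUnit L b f')
    (hG : f ^ p = frob p f' + p * G) (g : Laurent R n) {k m s : ℕ} (hkm : k ≤ p * m)
    (hs : 1 ≤ s) :
    ∃ e : Formal R n, cartier p (expansion f b g k) =
      ∑ r ∈ Finset.range s, (((Ring.choose (-(m : ℤ)) r : ℤ) : R) * (p : R) ^ r) •
        expansion f' b (cartierPoly p hp (g * f ^ (p * m - k) * G ^ r)) (m + r) +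
      (p : R) ^ s • e := by
  have hFp : toHahn L f ^ p = toHahn L (frob p f') + (p : Hahn R n) * toHahn L G := by
    rw [← map_pow, hG, map_add, map_mul, map_natCast]
  obtain ⟨Q, hQ⟩ := exists_inverse_pow_eq hf.mul_invHahn (hf'.frob hp).mul_invHahn hFp hkm hs
  have key : toHahn L g * invHahn L f ^ k = ∑ r ∈ Finset.range s,
      (((Ring.choose (-(m : ℤ)) r : ℤ) : R) * (p : R) ^ r) •
        (toHahn L (g * f ^ (p * m - k) * G ^ r) * invHahn L (frob p f') ^ (m + r)) +
      (p : R) ^ s • (toHahn L g * Q) := by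
    rw [hQ, mul_add, Finset.mul_sum]
    congr 1
    · refine Finset.sum_congr rfl fun r _ => ?_
      rw [Algebra.smul_def, map_mul (algebraMap R (Hahn R n)), map_pow (algebraMap R (Hahn R n)),
        map_natCast, map_intCast, map_mul (toHahn L), map_mul (toHahn L), map_pow (toHahn L),
        map_pow (toHahn L)]
      ring
    · rw [Algebra.smul_def, map_pow (algebraMap R (Hahn R n)), map_natCast]
      ring
  refine ⟨cartier p (toFormal L (toHahn L g * Q)), ?_⟩
  rw [hf.expansion_eq, key, map_add, map_sum, ← cartierLin_apply, map_add, map_sum, map_smul,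
    map_smul, cartierLin_apply]
  congr 1
  refine Finset.sum_congr rfl fun r _ => ?_
  rw [map_smul, map_smul, cartierLin_apply, cartier_frob_denominator hp hf']

/-! ### Derivations of rational functions -/

/-- A derivation acting on the coefficients of a Hahn series. -/
def derHahn (δ : Derivation ℤ R R) (a : Hahn R n) : Hahn R n := a.map (δ : R →ₗ[ℤ] R)

theorem coeff_derHahn (δ : Derivation ℤ R R) (a : Hahn R n) (γ : ExpGroup n) :
    (derHahn δ a).coeff γ = δ (a.coeff γ) := rfl

theorem derHahn_toHahn_mul (δ : Derivation ℤ R R) (L : (Fin n → ℤ) →+ ℝ) (P : Laurent R n)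
    (a : Hahn R n) :
    derHahn δ (toHahn L P * a) = toHahn L (coeffDer δ P) * a + toHahn L P * derHahn δ a := by
  induction P using AddMonoidAlgebra.induction_linear with
  | zero => ext γ; simp [coeff_derHahn]
  | add f g hf hg =>
    have h : toHahn L (coeffDer δ (f + g)) * a + toHahn L (f + g) * derHahn δ a =
        derHahn δ (toHahn L f * a) + derHahn δ (toHahn L g * a) := by
      rw [hf, hg, map_add, map_add, map_add]; ring
    rw [h, map_add, add_mul]
    ext γ
    simp [coeff_derHahn]
  | single v c =>
    ext γ
    rw [coeff_derHahn, HahnSeries.coeff_add, coeffDer_single, toHahn_single, toHahn_single,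
      HahnSeries.coeff_single_mul, HahnSeries.coeff_single_mul, HahnSeries.coeff_single_mul,
      coeff_derHahn, Derivation.leibniz, smul_eq_mul, smul_eq_mul]
    ring

/-- Differentiate f ω_u = x^u, whose right side has constant coefficients. -/
theorem IsVertexUnit.der_omega {L : (Fin n → ℤ) →+ ℝ} {b : Fin n → ℤ} {f : Laurent R n}
    (hf : IsVertexUnit L b f) (δ : Derivation ℤ R R) (u : Fin n → ℤ) :
    (fun w => δ (omega f b u w)) =
      expansion f b (-(AddMonoidAlgebra.single u 1 * coeffDer δ f)) 2 := by
  have h1 : (fun w => δ (omega f b u w)) =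
      toFormal L (derHahn δ (toHahn L (AddMonoidAlgebra.single u 1) * invHahn L f)) := by
    rw [omega, hf.expansion_eq, pow_one]
    rfl
  rw [h1, hf.expansion_eq]
  congr 1
  set a := toHahn L (AddMonoidAlgebra.single u (1 : R)) * invHahn L f with ha
  have h2 : toHahn L f * a = toHahn L (AddMonoidAlgebra.single u (1 : R)) * 1 := by
    rw [ha, mul_left_comm, hf.mul_invHahn]
  have h3 := congrArg (derHahn δ) h2
  rw [derHahn_toHahn_mul δ L f a, derHahn_toHahn_mul δ L _ 1, coeffDer_single, Derivation.map_one_eq_zero,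
    AddMonoidAlgebra.single_zero, map_zero, zero_mul, zero_add] at h3
  have h4 : derHahn δ (1 : Hahn R n) = 0 := by
    ext γ
    rw [coeff_derHahn, HahnSeries.coeff_one]
    split_ifs <;> simp
  rw [h4, mul_zero] at h3
  rw [map_neg, map_mul]
  linear_combination invHahn L f * h3 - derHahn δ a * hf.mul_invHahn

/-! ### Polytopes, faces and vertices -/

theorem toReal_add (u v : Fin n → ℤ) : toReal (u + v) = toReal u + toReal v := by
  ext i; simp [toReal]

theorem toReal_zsmul (k : ℤ) (u : Fin n → ℤ) : toReal (k • u) = (k : ℝ) • toReal u := by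
  ext i; simp [toReal]

theorem convex_newtonPolytope (f : Laurent R n) : Convex ℝ (newtonPolytope f) :=
  convex_convexHull ℝ _

theorem toReal_mem_newtonPolytope {f : Laurent R n} {u : Fin n → ℤ} (hu : f.coeff u ≠ 0) :
    toReal u ∈ newtonPolytope f :=
  subset_convexHull ℝ _ ⟨u, by simpa using hu, rfl⟩

/-- An extreme point is outside the hull of the remaining support points. That hull is compact, so
Hahn–Banach separates the point from it strictly. -/
theorem exists_isVertexUnit {f : Laurent R n} {b : Fin n → ℤ}
    (hb : toReal b ∈ (newtonPolytope f).extremePoints ℝ) (hfb : IsUnit (f.coeff b)) :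
    ∃ L : (Fin n → ℤ) →+ ℝ, IsVertexUnit L b f := by
  set S := toReal '' (f.coeff.support : Set (Fin n → ℤ)) with hS
  have hfin : (S \ {toReal b}).Finite := (f.coeff.support.finite_toSet.image _).sdiff
  have h1 : toReal b ∉ convexHull ℝ (S \ {toReal b}) := fun h =>
    (((convex_newtonPolytope f).mem_extremePoints_iff_mem_sdiff_convexHull_sdiff).1 hb).2
      (convexHull_mono (Set.sdiff_subset_sdiff_left (subset_convexHull ℝ S)) h)
  obtain ⟨l, c, hl, hc⟩ := geometric_hahn_banach_point_closed (convex_convexHull ℝ _)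
    (hfin.isCompact_convexHull ℝ).isClosed h1
  refine ⟨{ toFun := fun u => l (toReal u)
            map_zero' := by
              rw [show toReal (0 : Fin n → ℤ) = 0 by ext i; simp [toReal], map_zero]
            map_add' := fun u v => by rw [toReal_add, map_add] }, hfb, fun u hu hub => ?_⟩
  refine hl.trans (hc _ (subset_convexHull ℝ _ ⟨⟨u, by simpa using hu, rfl⟩, ?_⟩))
  rintro h
  apply hub
  ext i
  have := congrFun (Set.mem_singleton_iff.1 h) i
  simpa [toReal] using this

/-- After rescaling, the sum is a convex combination z with positive weight on a point x of μ. Were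
z on an exposed face, the exposing functional would be maximal at x too, putting x on that face.
This is how openness of μ lets numerators be multiplied by powers of f and G. -/
theorem IsOpenIn.add_mem_smul {Δ μ : Set (Fin n → ℝ)} (hΔ : Convex ℝ Δ) (hμ : IsOpenIn Δ μ)
    {j k : ℝ} (hj : 0 < j) (hk : 0 ≤ k) {x y : Fin n → ℝ} (hx : x ∈ j • μ) (hy : y ∈ k • Δ) :
    x + y ∈ (j + k) • μ := by
  obtain ⟨x, hx, rfl⟩ := hx
  obtain ⟨y, hy, rfl⟩ := hy
  have hjk : 0 < j + k := by linarith
  set z := (j / (j + k)) • x + (k / (j + k)) • y with hz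
  have hsum : (fun z => j • z) x + (fun z => k • z) y = (j + k) • z := by
    simp only [hz, smul_add, smul_smul]
    rw [mul_div_cancel₀ _ hjk.ne', mul_div_cancel₀ _ hjk.ne']
  have hzΔ : z ∈ Δ := hΔ (hμ.1 hx) hy (by positivity) (by positivity) (by field_simp)
  refine ⟨z, ?_, hsum.symm⟩
  by_contra hzμ
  obtain ⟨𝓕, h𝓕, hU⟩ := hμ.2
  obtain ⟨F, hF, hzF⟩ : z ∈ ⋃₀ 𝓕 := hU ▸ ⟨hzΔ, hzμ⟩
  obtain ⟨l, hl⟩ := h𝓕 F hF ⟨z, hzF⟩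
  have hmax : ∀ w ∈ Δ, l w ≤ l z := by rw [hl] at hzF; exact hzF.2
  have hxz : l z ≤ l x := by
    have h1 : l z = (j / (j + k)) * l x + (k / (j + k)) * l y := by
      rw [hz, map_add, map_smul, map_smul, smul_eq_mul, smul_eq_mul]
    have h2 := hmax y hy
    have h3 : (j + k) * l z = j * l x + k * l y := by rw [h1]; field_simp
    have h4 : k * l y ≤ k * l z := mul_le_mul_of_nonneg_left h2 hk
    have h5 : j * l z ≤ j * l x := by linarith
    exact le_of_mul_le_mul_left h5 hj
  have hxF : x ∈ F := by
    rw [hl]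
    exact ⟨hμ.1 hx, fun w hw => (hmax w hw).trans hxz⟩
  have : x ∈ Δ \ μ := hU ▸ ⟨F, hF, hxF⟩
  exact this.2 hx

/-- The support of `g` lies in `k • μ`. -/
def SuppIn (μ : Set (Fin n → ℝ)) (k : ℕ) (g : Laurent R n) : Prop :=
  ∀ u ∈ g.coeff.support, toReal u ∈ (k : ℝ) • μ

theorem exists_of_coeff_mul_ne_zero {g h : Laurent R n} {u : Fin n → ℤ}
    (hu : (g * h).coeff u ≠ 0) : ∃ v w, g.coeff v ≠ 0 ∧ h.coeff w ≠ 0 ∧ u = v + w := by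
  classical
  by_contra hne
  push Not at hne
  apply hu
  rw [AddMonoidAlgebra.coeff_mul]
  refine Finset.sum_eq_zero fun v hv => Finset.sum_eq_zero fun w hw => ?_
  exact if_neg fun h => hne v w (Finsupp.mem_support_iff.1 hv) (Finsupp.mem_support_iff.1 hw) h.symm

theorem SuppIn.mul {Δ μ : Set (Fin n → ℝ)} (hΔ : Convex ℝ Δ) (hμ : IsOpenIn Δ μ)
    {j k : ℕ} (hj : 1 ≤ j) {g h : Laurent R n} (hg : SuppIn μ j g) (hh : SuppIn Δ k h) :
    SuppIn μ (j + k) (g * h) := by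
  intro u hu
  obtain ⟨v, w, hv, hw, rfl⟩ := exists_of_coeff_mul_ne_zero (Finsupp.mem_support_iff.1 hu)
  rw [toReal_add, Nat.cast_add]
  exact hμ.add_mem_smul hΔ (by exact_mod_cast hj) (by positivity)
    (hg v (Finsupp.mem_support_iff.2 hv)) (hh w (Finsupp.mem_support_iff.2 hw))

theorem SuppIn.mul_self {Δ : Set (Fin n → ℝ)} (hΔ : Convex ℝ Δ) {j k : ℕ} {g h : Laurent R n}
    (hg : SuppIn Δ j g) (hh : SuppIn Δ k h) : SuppIn Δ (j + k) (g * h) := by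
  intro u hu
  obtain ⟨v, w, hv, hw, rfl⟩ := exists_of_coeff_mul_ne_zero (Finsupp.mem_support_iff.1 hu)
  rw [toReal_add, Nat.cast_add, hΔ.add_smul (by positivity) (by positivity)]
  exact Set.add_mem_add (hg v (Finsupp.mem_support_iff.2 hv)) (hh w (Finsupp.mem_support_iff.2 hw))

theorem SuppIn.pow {Δ : Set (Fin n → ℝ)} (hΔ : Convex ℝ Δ) (hne : Δ.Nonempty) {j : ℕ}
    {g : Laurent R n} (hg : SuppIn Δ j g) (k : ℕ) : SuppIn Δ (j * k) (g ^ k) := by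
  induction k with
  | zero =>
    intro u hu
    rw [pow_zero] at hu
    have hu0 : u = 0 := by
      classical
      by_contra h
      rw [AddMonoidAlgebra.one_def, AddMonoidAlgebra.coeff_single, Finsupp.mem_support_iff,
        Finsupp.single_apply, if_neg (Ne.symm h)] at hu
      exact hu rfl
    obtain ⟨x, hx⟩ := hne
    exact ⟨x, hx, by ext i; simp [hu0, toReal]⟩
  | succ k ih => rw [pow_succ, Nat.mul_succ]; exact ih.mul_self hΔ hg

theorem SuppIn.frob {Δ : Set (Fin n → ℝ)} {p : ℕ} (hp : p ≠ 0) {f : Laurent R n}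
    (hf : SuppIn Δ 1 f) : SuppIn Δ p (frob p f) := by
  intro u hu
  rw [Finsupp.mem_support_iff] at hu
  obtain ⟨v, rfl⟩ := exists_of_coeff_frob_ne_zero f u hu
  rw [coeff_frob hp] at hu
  have h := hf v (Finsupp.mem_support_iff.2 hu)
  rw [Nat.cast_one, one_smul] at h
  exact ⟨toReal v, h, by rw [toReal_zsmul]; simp⟩

theorem SuppIn.twist {Δ : Set (Fin n → ℝ)} {k : ℕ} {f : Laurent R n} (hf : SuppIn Δ k f)
    (σ : R →+* R) : SuppIn Δ k (twist σ f) :=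
  fun u hu => hf u (support_twist σ f hu)

theorem SuppIn.cartierPoly {μ : Set (Fin n → ℝ)} {p k : ℕ} (hp : p ≠ 0) {g : Laurent R n}
    (hg : SuppIn μ (p * k) g) : SuppIn μ k (cartierPoly p hp g) := by
  intro u hu
  rw [Finsupp.mem_support_iff, coeff_cartierPoly] at hu
  have h := hg _ (Finsupp.mem_support_iff.2 hu)
  rw [toReal_zsmul, Int.cast_natCast, Nat.cast_mul, mul_smul,
    Set.smul_mem_smul_set_iff₀ (by exact_mod_cast hp)] at h
  exact h

/-- Without p-torsion a coefficient of G can be nonzero only where P or Q has one. -/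
theorem SuppIn.of_natCast_mul [IsDomain R] [CharZero R] {Δ : Set (Fin n → ℝ)} {p k : ℕ}
    (hp : p ≠ 0) {P Q G : Laurent R n} (hP : SuppIn Δ k P) (hQ : SuppIn Δ k Q)
    (h : P = Q + p * G) : SuppIn Δ k G := by
  intro u hu
  have hc : P.coeff u = Q.coeff u + p * G.coeff u := by
    rw [h, AddMonoidAlgebra.coeff_add, Finsupp.add_apply, ← nsmul_eq_mul p G,
      AddMonoidAlgebra.coeff_smul_apply, nsmul_eq_mul]
  by_cases hP0 : P.coeff u = 0
  · refine hQ u (Finsupp.mem_support_iff.2 fun hQ0 => ?_)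
    rw [hP0, hQ0, zero_add] at hc
    rcases mul_eq_zero.1 hc.symm with h0 | h0
    · exact hp (by exact_mod_cast h0)
    · exact (Finsupp.mem_support_iff.1 hu) h0
  · exact hP u (Finsupp.mem_support_iff.2 hP0)

/-! ### Integrality of coefficients -/

/-- By completeness p lies in the Jacobson radical. -/
theorem isUnit_of_dvd_sub {p : ℕ} [IsAdicComplete (Ideal.span {(p : R)}) R] {x y : R}
    (hx : IsUnit x) (h : (p : R) ∣ x - y) : IsUnit y := by
  obtain ⟨u, rfl⟩ := hx
  obtain ⟨r, hr⟩ := h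
  have hJ := IsAdicComplete.le_jacobson_bot (Ideal.span {(p : R)})
    (Ideal.mem_span_singleton_self (p : R))
  have h1 := Ideal.mem_jacobson_bot.1 hJ (-(r * (↑u⁻¹ : R)))
  have h2 : y = u * ((p : R) * -(r * (↑u⁻¹ : R)) + 1) := by
    linear_combination -hr + (-(p : R) * r) * u.mul_inv * (-1)
  rw [h2]
  exact u.isUnit.mul h1

theorem isUnit_natCast_of_coprime {p q : ℕ} [IsAdicComplete (Ideal.span {(p : R)}) R]
    (h : q.Coprime p) : IsUnit (q : R) := by
  have h1 := Nat.gcd_eq_gcd_ab q p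
  rw [h] at h1
  have h2 : (1 : R) - q * (Nat.gcdA q p : R) = p * (Nat.gcdB q p : R) := by
    have := congrArg (Int.cast : ℤ → R) h1
    push_cast at this
    rw [this]; ring
  exact isUnit_of_mul_isUnit_left (isUnit_of_dvd_sub isUnit_one ⟨_, h2⟩)

/-- Legendre's formula bounds the valuation of r! by r/(p-1), and strictly by r when r ≥ 1. For odd
p the quotient p^r/r! tends to 0. For p = 2 it does not (r a power of 2 leaves a single factor 2),
hence the separate completion in that case. -/
theorem exists_factorial_mul_eq_pow {p : ℕ} (hp : p.Prime)
    [IsAdicComplete (Ideal.span {(p : R)}) R] (r : ℕ) :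
    ∃ ρ : R, (r.factorial : R) * ρ = (p : R) ^ r ∧ (1 ≤ r → (p : R) ∣ ρ) ∧
      (p ≠ 2 → (p : R) ^ (r / 2) ∣ ρ) := by
  have := Fact.mk hp
  obtain ⟨v, q, hq, hr⟩ := Nat.exists_eq_pow_mul_and_not_dvd (Nat.factorial_ne_zero r) p hp.ne_one
  have hv : padicValNat p r.factorial = v := by
    rw [hr, padicValNat.mul (pow_ne_zero _ hp.ne_zero) (by rintro rfl; exact hq (dvd_zero p)),
      padicValNat.prime_pow, padicValNat.eq_zero_of_not_dvd hq, add_zero]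
  have hleg := sub_one_mul_padicValNat_factorial (p := p) r
  rw [hv] at hleg
  have hp2 := hp.two_le
  have hvr : v ≤ r := by
    have : 1 * v ≤ (p - 1) * v := Nat.mul_le_mul_right _ (by omega)
    omega
  have hvlt : 1 ≤ r → v < r := by
    intro h1
    have : 1 * v ≤ (p - 1) * v := Nat.mul_le_mul_right _ (by omega)
    have := sub_one_mul_padicValNat_factorial_lt_of_ne_zero p (n := r) (by omega)
    rw [hv] at this
    omega
  have hv2 : p ≠ 2 → 2 * v ≤ r := by
    intro h
    have : 2 * v ≤ (p - 1) * v := Nat.mul_le_mul_right _ (by omega)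
    omega
  obtain ⟨w, hw⟩ := isUnit_natCast_of_coprime (R := R)
    ((Nat.Prime.coprime_iff_not_dvd hp).2 hq).symm
  refine ⟨(p : R) ^ (r - v) * (↑w⁻¹ : R), ?_, fun h => ?_, fun h => ?_⟩
  · rw [hr, Nat.cast_mul, Nat.cast_pow, ← hw]
    have h1 : (p : R) ^ v * (p : R) ^ (r - v) = (p : R) ^ r := by
      rw [← pow_add, Nat.add_sub_cancel' hvr]
    linear_combination h1 + (p : R) ^ v * (p : R) ^ (r - v) * w.mul_inv
  · exact (dvd_pow_self _ (by have := hvlt h; omega)).mul_right _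
  · exact (pow_dvd_pow _ (by have := hv2 h; omega)).mul_right _

theorem pow_mul_factorial_dvd (p j : ℕ) (hp : p ≠ 0) :
    p ^ j * j.factorial ∣ (p * j).factorial := by
  induction j with
  | zero => simp
  | succ j ih =>
    obtain ⟨q, rfl⟩ := Nat.exists_eq_succ_of_ne_zero hp
    have h1 : (q.succ * (j + 1)).factorial =
        q.succ * (j + 1) * (q.succ * j + q).factorial := by
      rw [show q.succ * (j + 1) = (q.succ * j + q) + 1 by rw [Nat.mul_succ]; rfl,
        Nat.factorial_succ]
    rw [h1, pow_succ, Nat.factorial_succ]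
    calc q.succ ^ j * q.succ * ((j + 1) * j.factorial)
        = q.succ * (j + 1) * (q.succ ^ j * j.factorial) := by ring
      _ ∣ _ := Nat.mul_dvd_mul_left _ (ih.trans (Nat.factorial_dvd_factorial (by omega)))

theorem choose_neg_mul_factorial (m r : ℕ) (hm : 1 ≤ m) :
    Ring.choose (-(m : ℤ)) r * ((m - 1).factorial * r.factorial) =
      (-1) ^ r * ((m + r - 1).factorial : ℤ) := by
  have h1 : ((m : ℤ) + r - 1) = ((m + r - 1 : ℕ) : ℤ) := by
    rw [Nat.cast_sub (by omega)]; push_cast; ring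
  rw [Ring.choose_neg, h1, Ring.choose_natCast]
  have h2 : (Nat.choose (m + r - 1) r) * ((m - 1).factorial * r.factorial) =
      (m + r - 1).factorial := by
    have := Nat.add_choose_mul_factorial_mul_factorial (m - 1) r
    rw [show m + r - 1 = (m - 1) + r by omega, ← this]
    ring
  rw [← h2, Units.smul_def, Int.coe_negOnePow_natCast, smul_eq_mul]
  push_cast
  ring

/-- Up to sign c is ((k-1)!/(m-1)!) · (p^r/r!). The first factor is divisible by p^(m-1) and the
second by p when r ≥ 1, so only m = 1, r = 0 escapes divisibility by p. -/
theorem exists_factorial_mul_choose_eq {p : ℕ} (hp : p.Prime)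
    [IsAdicComplete (Ideal.span {(p : R)}) R] {k m : ℕ} (r : ℕ) (hm : 1 ≤ m)
    (hkm : p * (m - 1) ≤ k - 1) :
    ∃ c : R, ((k - 1).factorial : R) * (((Ring.choose (-(m : ℤ)) r : ℤ) : R) * (p : R) ^ r) =
      c * ((m + r - 1).factorial : R) ∧ (1 < m + r → (p : R) ∣ c) ∧
      (p ≠ 2 → (p : R) ^ (r / 2) ∣ c) := by
  obtain ⟨ρ, hρ, hρ1, hρ2⟩ := exists_factorial_mul_eq_pow (R := R) hp r
  obtain ⟨A, hA⟩ := (pow_mul_factorial_dvd p (m - 1) hp.ne_zero).trans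
    (Nat.factorial_dvd_factorial hkm)
  have hch := congrArg (Int.cast : ℤ → R) (choose_neg_mul_factorial m r hm)
  push_cast at hch
  refine ⟨(-1) ^ r * ((p : R) ^ (m - 1) * A) * ρ, ?_, fun h => ?_, fun h => ?_⟩
  · rw [hA, ← hρ]
    push_cast
    linear_combination (p : R) ^ (m - 1) * A * ρ * hch
  · rcases Nat.lt_or_ge 1 m with h1 | h1
    · exact (((dvd_pow_self (p : R) (by omega)).mul_right _).mul_left _).mul_right _
    · exact (hρ1 (by omega)).mul_left _
  · exact (hρ2 h).mul_left _

/-! ### Completions -/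

theorem mem_span_pow_smul_iff {M : Type*} [AddCommGroup M] [Module R M] (N : Submodule R M)
    (d : R) (s : ℕ) (x : M) : x ∈ Ideal.span {d} ^ s • N ↔ ∃ y ∈ N, x = d ^ s • y := by
  rw [Ideal.span_singleton_pow, Submodule.ideal_span_singleton_smul,
    Submodule.mem_smul_pointwise_iff_exists]
  simp only [eq_comm]

theorem mem_omegaHat_two (f : Laurent R n) (b : Fin n → ℤ) (μ : Set (Fin n → ℝ))
    (a : Formal R n) : a ∈ OmegaHat 2 f b μ ↔
      ∀ s : ℕ, ∃ w ∈ Omega f b μ, ∃ e : Formal R n, a = w + ((2 : ℕ) : R) ^ s • e := by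
  rw [OmegaHat, if_pos rfl, Submodule.mem_iInf]
  refine forall_congr' fun s => ?_
  rw [Submodule.mem_sup]
  constructor
  · rintro ⟨w, hw, z, hz, rfl⟩
    obtain ⟨e, -, rfl⟩ := (mem_span_pow_smul_iff _ _ _ _).1 hz
    exact ⟨w, hw, e, rfl⟩
  · rintro ⟨w, hw, e, rfl⟩
    exact ⟨w, hw, _, (mem_span_pow_smul_iff _ _ _ _).2 ⟨e, trivial, rfl⟩, rfl⟩

/-- Successive approximations must differ by p^s times elements of Ω_f(μ) itself, which is more than
being p-adically close as formal series. -/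
theorem mem_omegaHat_of_ne_two {p : ℕ} (hp2 : p ≠ 2) (f : Laurent R n) (b : Fin n → ℤ)
    (μ : Set (Fin n → ℝ)) (a : Formal R n) : a ∈ OmegaHat p f b μ ↔
      ∃ W : ℕ → Formal R n, (∀ s, W s ∈ Omega f b μ) ∧
        (∀ s, ∃ w ∈ Omega f b μ, W (s + 1) - W s = (p : R) ^ s • w) ∧
        ∀ s, ∃ e : Formal R n, a = W s + (p : R) ^ s • e := by
  rw [OmegaHat, if_neg hp2, Submodule.mem_comap]
  constructor
  · rintro ⟨x, hx⟩
    obtain ⟨V, rfl⟩ := AdicCompletion.mk_surjective _ _ x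
    refine ⟨fun s => (V s : Formal R n), fun s => (V s).2, fun s => ?_, fun s => ?_⟩
    · have h := V.2 (Nat.le_succ s)
      rw [SModEq.sub_mem] at h
      obtain ⟨y, -, hy⟩ := (mem_span_pow_smul_iff _ _ _ _).1 h
      refine ⟨-y.1, neg_mem y.2, ?_⟩
      rw [smul_neg, ← neg_sub]
      exact congrArg Neg.neg (congrArg Subtype.val hy)
    · have h := congrArg (fun z => z.val s) hx
      rw [LinearMap.restrictScalars_apply, AdicCompletion.map_mk] at h
      have h' : (Submodule.Quotient.mk (V s : Formal R n) : Formal R n ⧸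
          (Ideal.span {(p : R)} ^ s • ⊤ : Submodule R (Formal R n))) =
          Submodule.Quotient.mk a := h
      rw [Submodule.Quotient.eq] at h'
      obtain ⟨y, -, hy⟩ := (mem_span_pow_smul_iff _ _ _ _).1 h'
      exact ⟨-y, by rw [smul_neg, ← hy]; abel⟩
  · rintro ⟨W, hW, hc, ha⟩
    refine ⟨AdicCompletion.mk _ _ (AdicCompletion.AdicCauchySequence.mk _ _
      (fun s => (⟨W s, hW s⟩ : Omega f b μ)) fun s => ?_), ?_⟩
    · rw [SModEq.sub_mem]
      obtain ⟨w, hw, h⟩ := hc s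
      refine (mem_span_pow_smul_iff _ _ _ _).2 ⟨-⟨w, hw⟩, trivial, Subtype.ext ?_⟩
      change W s - W (s + 1) = (p : R) ^ s • -w
      rw [smul_neg, ← h, neg_sub]
    · rw [LinearMap.restrictScalars_apply, AdicCompletion.map_mk]
      refine AdicCompletion.ext fun s => ?_
      change (Submodule.Quotient.mk (W s) : Formal R n ⧸
          (Ideal.span {(p : R)} ^ s • ⊤ : Submodule R (Formal R n))) =
          Submodule.Quotient.mk a
      rw [Submodule.Quotient.eq]
      obtain ⟨e, he⟩ := ha s
      exact (mem_span_pow_smul_iff _ _ _ _).2 ⟨-e, trivial, by rw [he, smul_neg]; abel⟩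

theorem omega_le_omegaHat (p : ℕ) (f : Laurent R n) (b : Fin n → ℤ) (μ : Set (Fin n → ℝ)) :
    Omega f b μ ≤ OmegaHat p f b μ := by
  intro a ha
  by_cases hp2 : p = 2
  · subst hp2
    exact (mem_omegaHat_two f b μ a).2 fun s => ⟨a, ha, 0, by simp⟩
  · exact (mem_omegaHat_of_ne_two hp2 f b μ a).2
      ⟨fun _ => a, fun _ => ha, fun s => ⟨0, zero_mem _, by simp⟩, fun s => ⟨0, by simp⟩⟩

/-- Iterating x = w + p y inside X writes a as a p-adic series with terms in Ω_f(μ). -/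
theorem mem_omegaHat_of_chain {p : ℕ} (hp2 : p ≠ 2) {f : Laurent R n} {b : Fin n → ℤ}
    {μ : Set (Fin n → ℝ)} (X : Set (Formal R n))
    (hX : ∀ x ∈ X, ∃ w ∈ Omega f b μ, ∃ y ∈ X, x = w + (p : R) • y) {a : Formal R n}
    (ha : a ∈ X) : a ∈ OmegaHat p f b μ := by
  choose! w hw y hy hxy using hX
  have hmem : ∀ s, y^[s] a ∈ X := fun s => by
    induction s with
    | zero => exact ha
    | succ s ih => rw [Function.iterate_succ_apply']; exact hy _ ih
  refine (mem_omegaHat_of_ne_two hp2 f b μ a).2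
    ⟨fun s => ∑ i ∈ Finset.range s, (p : R) ^ i • w (y^[i] a), fun s => ?_, fun s => ?_,
      fun s => ⟨y^[s] a, ?_⟩⟩
  · exact Submodule.sum_mem _ fun i _ => Submodule.smul_mem _ _ (hw _ (hmem i))
  · exact ⟨_, hw _ (hmem s), by beta_reduce; rw [Finset.sum_range_succ, add_sub_cancel_left]⟩
  · induction s with
    | zero => simp
    | succ s ih =>
      beta_reduce at ih ⊢
      rw [Finset.sum_range_succ, add_assoc, pow_succ, mul_smul, ← smul_add,
        Function.iterate_succ_apply', ← hxy _ (hmem s)]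
      exact ih

/-! ### Completions over torsion-free coefficients: cancelling `p` -/

section Torsion

variable [IsDomain R] [CharZero R]

theorem smul_cancel {p : ℕ} (hp : p ≠ 0) {x y : Formal R n}
    (h : (p : R) • x = (p : R) • y) : x = y :=
  smul_right_injective _ (by exact_mod_cast hp) h

/-- Converse of `mem_omegaHat_of_chain`: split off the first approximation; the tail of the series
can be divided by p and stays in the completion. -/
theorem exists_chain_of_mem_omegaHat {p : ℕ} (hp : p ≠ 0) (hp2 : p ≠ 2) {f : Laurent R n}
    {b : Fin n → ℤ} {μ : Set (Fin n → ℝ)} {a : Formal R n} (ha : a ∈ OmegaHat p f b μ) :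
    ∃ w ∈ Omega f b μ, ∃ a' ∈ OmegaHat p f b μ, a = w + (p : R) • a' := by
  obtain ⟨W, hW, hc, haW⟩ := (mem_omegaHat_of_ne_two hp2 f b μ a).1 ha
  obtain ⟨e, he⟩ := haW 1
  rw [pow_one] at he
  refine ⟨W 1, hW 1, e, ?_, he⟩
  choose w hw hd using hc
  have hsum : ∀ s, W (s + 1) = W 1 + (p : R) • ∑ i ∈ Finset.range s, (p : R) ^ i • w (i + 1) := by
    intro s
    induction s with
    | zero => simp
    | succ s ih =>
      rw [Finset.sum_range_succ, smul_add, ← add_assoc, ← ih, ← mul_smul, ← pow_succ', ← hd]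
      abel
  refine (mem_omegaHat_of_ne_two hp2 f b μ e).2
    ⟨fun s => ∑ i ∈ Finset.range s, (p : R) ^ i • w (i + 1), fun s => ?_, fun s => ?_,
      fun s => ?_⟩
  · exact Submodule.sum_mem _ fun i _ => Submodule.smul_mem _ _ (hw _)
  · exact ⟨_, hw _, by beta_reduce; rw [Finset.sum_range_succ, add_sub_cancel_left]⟩
  · obtain ⟨c, hc⟩ := haW (s + 1)
    refine ⟨c, smul_cancel hp ?_⟩
    rw [smul_add, ← mul_smul, ← pow_succ']
    rw [hsum, he] at hc
    rw [add_assoc] at hc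
    exact add_left_cancel hc

/-- A series of elements of `Ω_f(μ)` with coefficients tending to `0`, all divisible by `p`, has
sum in `p Ω̂_f(μ)`. -/
theorem exists_smul_omegaHat_of_series {p : ℕ} (hp : p ≠ 0) {f : Laurent R n} {b : Fin n → ℤ}
    {μ : Set (Fin n → ℝ)} {y : Formal R n} {c : ℕ → R} {T : ℕ → Formal R n}
    (hT : ∀ r, T r ∈ Omega f b μ) (hc1 : ∀ r, (p : R) ∣ c r)
    (hc2 : p ≠ 2 → ∀ r, (p : R) ^ (r / 2) ∣ c r)
    (hy : ∀ s, 1 ≤ s → ∃ e : Formal R n, y = ∑ r ∈ Finset.range s, c r • T r + (p : R) ^ s • e) :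
    ∃ z ∈ OmegaHat p f b μ, y = (p : R) • z := by
  choose c' hc' using hc1
  have hp0 : (p : R) ≠ 0 := by exact_mod_cast hp
  have hsum : ∀ s, ∑ r ∈ Finset.range s, c r • T r =
      (p : R) • ∑ r ∈ Finset.range s, c' r • T r := by
    intro s
    rw [Finset.smul_sum]
    exact Finset.sum_congr rfl fun r _ => by rw [hc', mul_smul]
  have hmem : ∀ s, ∑ r ∈ Finset.range s, c' r • T r ∈ Omega f b μ := fun s =>
    Submodule.sum_mem _ fun r _ => Submodule.smul_mem _ _ (hT r)
  obtain ⟨e₁, he₁⟩ := hy 1 le_rfl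
  set z := ∑ r ∈ Finset.range 1, c' r • T r + e₁ with hz
  have hyz : y = (p : R) • z := by rw [he₁, hsum, hz, pow_one, smul_add]
  have happrox : ∀ s, ∃ e : Formal R n,
      z = ∑ r ∈ Finset.range (s + 1), c' r • T r + (p : R) ^ s • e := by
    intro s
    obtain ⟨e, he⟩ := hy (s + 1) (by omega)
    refine ⟨e, smul_cancel hp ?_⟩
    rw [← hyz, smul_add, ← hsum, ← mul_smul, ← pow_succ']
    exact he
  refine ⟨z, ?_, hyz⟩
  by_cases hp2 : p = 2
  · subst hp2
    refine (mem_omegaHat_two f b μ z).2 fun s => ?_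
    obtain ⟨e, he⟩ := happrox s
    exact ⟨_, hmem _, e, he⟩
  · have hc3 : ∀ s r, 2 * s + 2 ≤ r → ∃ d, c' r = (p : R) ^ s * d := by
      intro s r hr
      obtain ⟨d, hd⟩ := (pow_dvd_pow (p : R) (by omega : s + 1 ≤ r / 2)).trans (hc2 hp2 r)
      refine ⟨d, mul_left_cancel₀ hp0 ?_⟩
      rw [← hc', hd, pow_succ']; ring
    -- Since c r gains a power of p only every second step, partial sums advance two terms at a
    -- time; the offset 2 pays for the division by p.
    refine (mem_omegaHat_of_ne_two hp2 f b μ z).2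
      ⟨fun s => ∑ r ∈ Finset.range (2 * s + 2), c' r • T r, fun s => hmem _, fun s => ?_,
        fun s => ?_⟩
    · obtain ⟨d₁, hd₁⟩ := hc3 s (2 * s + 2) le_rfl
      obtain ⟨d₂, hd₂⟩ := hc3 s (2 * s + 3) (by omega)
      refine ⟨d₁ • T (2 * s + 2) + d₂ • T (2 * s + 3),
        add_mem (Submodule.smul_mem _ _ (hT _)) (Submodule.smul_mem _ _ (hT _)), ?_⟩
      beta_reduce
      rw [show 2 * (s + 1) + 2 = (2 * s + 2) + 1 + 1 by ring, Finset.sum_range_succ,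
        Finset.sum_range_succ, hd₁, show 2 * s + 2 + 1 = 2 * s + 3 by ring, hd₂, smul_add, mul_smul,
        mul_smul]
      abel
    · obtain ⟨e, he⟩ := happrox (2 * s + 1)
      refine ⟨(p : R) ^ (s + 1) • e, ?_⟩
      rw [← mul_smul, ← pow_add, show s + (s + 1) = 2 * s + 1 by ring]
      exact he

end Torsion

/-! ### The leading part of `Ω_f(μ)` -/

theorem IsVertexUnit.polyMul_omega {L : (Fin n → ℤ) →+ ℝ} {b : Fin n → ℤ} {f : Laurent R n}
    (hf : IsVertexUnit L b f) (P : Laurent R n) (u : Fin n → ℤ) :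
    polyMul (P * f) (omega f b u) = (P * AddMonoidAlgebra.single u 1).coeff := by
  rw [omega, hf.expansion_eq, ← toFormal_toHahn_mul, ← toFormal_toHahn L, pow_one,
    map_mul (toHahn L) P f, map_mul (toHahn L) P]
  congr 1
  linear_combination toHahn L P * toHahn L (AddMonoidAlgebra.single u (1 : R)) * hf.mul_invHahn

/-- The functionals given by f/x^v are dual to the ω_u, so they read off the coefficients of a
combination; this also yields γ_1 = 1. -/
theorem IsVertexUnit.ct_omega {L : (Fin n → ℤ) →+ ℝ} {b : Fin n → ℤ} {f : Laurent R n}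
    (hf : IsVertexUnit L b f) (u v : Fin n → ℤ) [Decidable (u = v)] :
    ct (f * AddMonoidAlgebra.single (-v) 1) (omega f b u) = if u = v then 1 else 0 := by
  classical
  rw [ct_apply, mul_comm, hf.polyMul_omega, AddMonoidAlgebra.single_mul_single,
    AddMonoidAlgebra.coeff_single, Finsupp.single_apply]
  simp only [neg_add_eq_zero, mul_one, eq_comm]

theorem IsVertexUnit.ct_sum_omega {L : (Fin n → ℤ) →+ ℝ} {b : Fin n → ℤ} {f : Laurent R n}
    (hf : IsVertexUnit L b f) {S : Finset (Fin n → ℤ)} (c : S → R) (v : S) :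
    ct (f * AddMonoidAlgebra.single (-(v : Fin n → ℤ)) 1) (∑ u : S, c u • omega f b u) = c v := by
  classical
  rw [map_sum, Finset.sum_eq_single v]
  · rw [map_smul, hf.ct_omega, if_pos rfl, smul_eq_mul, mul_one]
  · intro u _ huv
    rw [map_smul, hf.ct_omega, if_neg fun h => huv (Subtype.ext h), smul_zero]
  · intro h; exact absurd (Finset.mem_univ v) h

theorem IsVertexUnit.expansion_eq_sum {L : (Fin n → ℤ) →+ ℝ} {b : Fin n → ℤ} {f : Laurent R n}
    (hf : IsVertexUnit L b f) {S : Finset (Fin n → ℤ)} {g : Laurent R n}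
    (hg : g.coeff.support ⊆ S) :
    expansion f b g 1 = ∑ v : S, g.coeff v • omega f b v := by
  rw [Finset.sum_coe_sort S fun v => g.coeff v • omega f b v]
  have h1 : g = ∑ v ∈ S, g.coeff v • AddMonoidAlgebra.single v (1 : R) := by
    ext u
    classical
    simp only [AddMonoidAlgebra.coeff_sum, Finsupp.finsetSum_apply,
      AddMonoidAlgebra.coeff_smul_apply, AddMonoidAlgebra.coeff_single, Finsupp.single_apply,
      smul_eq_mul, mul_ite, mul_one, mul_zero, Finset.sum_ite_eq']
    split_ifs with hu
    · rfl
    · by_contra h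
      exact hu (hg (Finsupp.mem_support_iff.2 h))
  conv_lhs => rw [h1]
  rw [hf.expansion_eq, map_sum, Finset.sum_mul, map_sum]
  refine Finset.sum_congr rfl fun v _ => ?_
  rw [map_smul, smul_mul_assoc, map_smul, omega, hf.expansion_eq]

/-- A polynomial supported in the polytope with a unit coefficient at the vertex `b`, together
with the finite set `S` of lattice points of the open subset `μ`. -/
structure Setting (Δ μ : Set (Fin n → ℝ)) (S : Finset (Fin n → ℤ)) (L : (Fin n → ℤ) →+ ℝ)
    (b : Fin n → ℤ) (f : Laurent R n) : Prop where
  convex : Convex ℝ Δ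
  isOpenIn : IsOpenIn Δ μ
  mem_iff : ∀ u, u ∈ S ↔ toReal u ∈ μ
  supp : SuppIn Δ 1 f
  vertex : IsVertexUnit L b f

theorem Setting.twist {Δ μ : Set (Fin n → ℝ)} {S : Finset (Fin n → ℤ)} {L : (Fin n → ℤ) →+ ℝ}
    {b : Fin n → ℤ} {f : Laurent R n} (hf : Setting Δ μ S L b f) (σ : R →+* R) :
    Setting Δ μ S L b (twist σ f) where
  convex := hf.convex
  isOpenIn := hf.isOpenIn
  mem_iff := hf.mem_iff
  supp := hf.supp.twist σ
  vertex := hf.vertex.twist σ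

theorem Setting.nonempty [Nontrivial R] {Δ μ : Set (Fin n → ℝ)} {S : Finset (Fin n → ℤ)}
    {L : (Fin n → ℤ) →+ ℝ} {b : Fin n → ℤ} {f : Laurent R n} (hf : Setting Δ μ S L b f) :
    Δ.Nonempty := by
  have := hf.supp b (Finsupp.mem_support_iff.2 hf.vertex.unit.ne_zero)
  rw [Nat.cast_one, one_smul] at this
  exact ⟨_, this⟩

theorem Setting.omega_mem {Δ μ : Set (Fin n → ℝ)} {S : Finset (Fin n → ℤ)}
    {L : (Fin n → ℤ) →+ ℝ} {b : Fin n → ℤ} {f : Laurent R n} (hf : Setting Δ μ S L b f)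
    {u : Fin n → ℤ} (hu : u ∈ S) : omega f b u ∈ Omega f b μ := by
  refine Submodule.subset_span ⟨1, AddMonoidAlgebra.single u 1, le_rfl, fun v hv => ?_, ?_⟩
  · rw [Nat.cast_one, one_smul]
    have : v = u := by
      classical
      by_contra h
      rw [AddMonoidAlgebra.coeff_single, Finsupp.mem_support_iff, Finsupp.single_apply,
        if_neg (Ne.symm h)] at hv
      exact hv rfl
    rw [this]
    exact (hf.mem_iff u).1 hu
  · simp [omega]

theorem Setting.der_omega_mem {Δ μ : Set (Fin n → ℝ)} {S : Finset (Fin n → ℤ)}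
    {L : (Fin n → ℤ) →+ ℝ} {b : Fin n → ℤ} {f : Laurent R n} (hf : Setting Δ μ S L b f)
    (δ : Derivation ℤ R R) {u : Fin n → ℤ} (hu : u ∈ S) :
    (fun w => δ (omega f b u w)) ∈ Omega f b μ := by
  rw [hf.vertex.der_omega]
  refine Submodule.subset_span ⟨2, -(AddMonoidAlgebra.single u 1 * coeffDer δ f), by norm_num, ?_,
    by simp⟩
  have h1 : SuppIn μ 1 (-AddMonoidAlgebra.single u (1 : R)) := by
    intro v hv
    have : v = u := by
      classical
      by_contra h
      rw [AddMonoidAlgebra.coeff_neg, AddMonoidAlgebra.coeff_single, Finsupp.mem_support_iff,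
        Finsupp.neg_apply, Finsupp.single_apply, if_neg (Ne.symm h), neg_zero] at hv
      exact hv rfl
    rw [this, Nat.cast_one, one_smul]
    exact (hf.mem_iff u).1 hu
  have h2 : SuppIn Δ 1 (coeffDer δ f) := by
    intro v hv
    refine hf.supp v (Finsupp.mem_support_iff.2 fun h => ?_)
    rw [Finsupp.mem_support_iff, coeff_coeffDer, h, map_zero] at hv
    exact hv rfl
  rw [← neg_mul]
  exact h1.mul hf.convex hf.isOpenIn le_rfl h2

section

/-! ### The Cartier operator on the completion of `Ω_f(μ)` -/

/-- The series `∑_v d_v ω_v + p z` with `z` in the completion of `Ω_f(μ)`. -/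
def leadingSup (p : ℕ) (f : Laurent R n) (b : Fin n → ℤ) (μ : Set (Fin n → ℝ))
    (S : Finset (Fin n → ℤ)) : Submodule R (Formal R n) :=
  Submodule.span R (omega f b '' S) ⊔ (p : R) • OmegaHat p f b μ

theorem mem_leadingSup {p : ℕ} {f : Laurent R n} {b : Fin n → ℤ} {μ : Set (Fin n → ℝ)}
    {S : Finset (Fin n → ℤ)} {a : Formal R n} : a ∈ leadingSup p f b μ S ↔
      ∃ d : S → R, ∃ z ∈ OmegaHat p f b μ, a = ∑ v : S, d v • omega f b v + (p : R) • z := by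
  rw [leadingSup, Submodule.mem_sup]
  simp only [Submodule.mem_span_image_finset_iff_exists_fun, Submodule.mem_smul_pointwise_iff_exists]
  constructor
  · rintro ⟨_, ⟨d, rfl⟩, _, ⟨z, hz, rfl⟩, rfl⟩
    exact ⟨d, z, hz, rfl⟩
  · rintro ⟨d, z, hz, rfl⟩
    exact ⟨_, ⟨d, rfl⟩, _, ⟨z, hz, rfl⟩, rfl⟩

theorem Setting.leadingSup_le {Δ μ : Set (Fin n → ℝ)} {S : Finset (Fin n → ℤ)}
    {L : (Fin n → ℤ) →+ ℝ} {b : Fin n → ℤ} {f : Laurent R n} (hf : Setting Δ μ S L b f) (p : ℕ) :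
    leadingSup p f b μ S ≤ OmegaHat p f b μ := by
  intro a ha
  obtain ⟨d, z, hz, rfl⟩ := mem_leadingSup.1 ha
  exact add_mem (Submodule.sum_mem _ fun v _ => Submodule.smul_mem _ _
    (omega_le_omegaHat p f b μ (hf.omega_mem v.2))) (Submodule.smul_mem _ _ hz)

variable [IsDomain R] [CharZero R]

/-- In the expansion of the Cartier image, the r-th term is c_r times a generator of pole order m +
r, with p dividing c_r unless m + r = 1. The exceptional term has a simple pole and is a combination
of the ω_v. -/
theorem Setting.cartier_generator_mem {Δ μ : Set (Fin n → ℝ)} {S : Finset (Fin n → ℤ)}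
    {L : (Fin n → ℤ) →+ ℝ} {b : Fin n → ℤ} {f : Laurent R n} (hf : Setting Δ μ S L b f)
    {p : ℕ} (hp : p.Prime) [IsAdicComplete (Ideal.span {(p : R)}) R] {σ : R →+* R}
    (hσ : IsFrobeniusLift p σ) {k : ℕ} (hk : 1 ≤ k) {g : Laurent R n} (hg : SuppIn μ k g) :
    cartier p (((k - 1).factorial : R) • expansion f b g k) ∈
      leadingSup p (DworkCrystal.twist σ f) b μ S := by
  have hp0 := hp.ne_zero
  set f' := DworkCrystal.twist σ f with hf'def
  have hf' : Setting Δ μ S L b f' := hf.twist σ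
  obtain ⟨G, hG⟩ := natCast_dvd_pow_sub_frob_twist hp hσ f
  have hG' : f ^ p = frob p f' + p * G := by rw [← hG]; ring
  have hfp : SuppIn Δ p (f ^ p) := by simpa using hf.supp.pow hf.convex hf.nonempty p
  have hGs : SuppIn Δ p G := hfp.of_natCast_mul hp0 (hf'.supp.frob hp0) hG'
  -- m is k/p rounded up: large enough for the binomial expansion, small enough that p^(m-1) (m-1)!
  -- divides (k-1)!.
  obtain ⟨m, hm1, hkm, hmk⟩ : ∃ m, 1 ≤ m ∧ k ≤ p * m ∧ p * (m - 1) ≤ k - 1 := by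
    refine ⟨(k - 1) / p + 1, Nat.le_add_left 1 _, ?_, ?_⟩
    · have := Nat.div_add_mod (k - 1) p
      have := Nat.mod_lt (k - 1) hp.pos
      rw [mul_add]
      omega
    · rw [Nat.add_sub_cancel]
      exact Nat.mul_div_le _ _
  have hsupp : ∀ r, SuppIn μ (m + r) (cartierPoly p hp0 (g * f ^ (p * m - k) * G ^ r)) := by
    intro r
    apply SuppIn.cartierPoly hp0
    have h1 : SuppIn Δ (p * m - k) (f ^ (p * m - k)) := by
      simpa using hf.supp.pow hf.convex hf.nonempty (p * m - k)
    have h2 := (hg.mul hf.convex hf.isOpenIn hk h1).mul hf.convex hf.isOpenIn (by omega)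
      (hGs.pow hf.convex hf.nonempty r)
    rwa [Nat.add_sub_cancel' hkm, ← mul_add] at h2
  choose c hc hc1 hc2 using fun r => exists_factorial_mul_choose_eq (R := R) hp r hm1 hmk
  set E : ℕ → Formal R n := fun r =>
    expansion f' b (cartierPoly p hp0 (g * f ^ (p * m - k) * G ^ r)) (m + r) with hE
  set T : ℕ → Formal R n := fun r => ((m + r - 1).factorial : R) • E r with hTdef
  have hT : ∀ r, T r ∈ Omega f' b μ := fun r =>
    Submodule.subset_span ⟨m + r, _, by omega, hsupp r, rfl⟩
  have hy : ∀ s, 1 ≤ s → ∃ e : Formal R n,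
      cartier p (((k - 1).factorial : R) • expansion f b g k) =
        ∑ r ∈ Finset.range s, c r • T r + (p : R) ^ s • e := by
    intro s hs
    obtain ⟨e, he⟩ := cartier_expansion hp0 hf.vertex hf'.vertex hG' g hkm hs
    refine ⟨((k - 1).factorial : R) • e, ?_⟩
    rw [← cartierLin_apply, map_smul, cartierLin_apply, he, smul_add, Finset.smul_sum,
      smul_comm ((p : R) ^ s)]
    congr 1
    exact Finset.sum_congr rfl fun r _ => by rw [hTdef, smul_smul, hc, mul_smul]
  rw [mem_leadingSup]
  rcases Nat.lt_or_ge 1 m with hm | hm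
  · obtain ⟨z, hz, hyz⟩ := exists_smul_omegaHat_of_series hp0 hT (fun r => hc1 r (by omega))
      (fun h r => hc2 r h) hy
    exact ⟨0, z, hz, by simpa using hyz⟩
  · obtain rfl : m = 1 := by omega
    -- The simple-pole term r = 0 is set aside, its coefficient having no factor p; the remaining
    -- series is handled as before.
    set c' : ℕ → R := fun r => if r = 0 then 0 else c r with hc'
    obtain ⟨z, hz, hyz⟩ := exists_smul_omegaHat_of_series (c := c') (T := T)
      (y := cartier p (((k - 1).factorial : R) • expansion f b g k) - c 0 • T 0) hp0 hT
      (fun r => by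
        simp only [hc']
        split_ifs with h
        · exact dvd_zero _
        · exact hc1 r (by omega))
      (fun h2 r => by
        simp only [hc']
        split_ifs with h
        · exact dvd_zero _
        · exact hc2 r h2)
      (fun s hs => by
        obtain ⟨e, he⟩ := hy s hs
        obtain ⟨t, rfl⟩ : ∃ t, s = t + 1 := ⟨s - 1, by omega⟩
        refine ⟨e, ?_⟩
        rw [he, Finset.sum_range_succ', Finset.sum_range_succ']
        simp [hc']
        abel)
    have hsub : (cartierPoly p hp0 (g * f ^ (p * 1 - k) * G ^ 0)).coeff.support ⊆ S := by
      intro u hu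
      have h := hsupp 0 u hu
      rw [add_zero, Nat.cast_one, one_smul] at h
      exact (hf.mem_iff u).2 h
    have hT0 : T 0 = ∑ v : S, (cartierPoly p hp0 (g * f ^ (p * 1 - k) * G ^ 0)).coeff v •
        omega f' b v := by
      rw [← hf'.vertex.expansion_eq_sum hsub]
      simp [hTdef, hE]
    refine ⟨fun v => c 0 * (cartierPoly p hp0 (g * f ^ (p * 1 - k) * G ^ 0)).coeff v, z, hz, ?_⟩
    rw [← hyz]
    simp only [mul_smul]
    rw [← Finset.smul_sum, ← hT0]
    abel

theorem Setting.cartier_omega_mem {Δ μ : Set (Fin n → ℝ)} {S : Finset (Fin n → ℤ)}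
    {L : (Fin n → ℤ) →+ ℝ} {b : Fin n → ℤ} {f : Laurent R n} (hf : Setting Δ μ S L b f)
    {p : ℕ} (hp : p.Prime) [IsAdicComplete (Ideal.span {(p : R)}) R] {σ : R →+* R}
    (hσ : IsFrobeniusLift p σ) {a : Formal R n} (ha : a ∈ Omega f b μ) :
    cartier p a ∈ leadingSup p (DworkCrystal.twist σ f) b μ S := by
  suffices h : Omega f b μ ≤ (leadingSup p (DworkCrystal.twist σ f) b μ S).comap (cartierLin p) from
    h ha
  refine Submodule.span_le.2 ?_
  rintro _ ⟨k, g, hk, hg, rfl⟩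
  exact hf.cartier_generator_mem hp hσ hk hg

/-- The Cartier operator maps the completion of `Ω_f(μ)` into `∑_v R ω_v^σ + p Ω̂`. -/
theorem Setting.cartier_mem {Δ μ : Set (Fin n → ℝ)} {S : Finset (Fin n → ℤ)}
    {L : (Fin n → ℤ) →+ ℝ} {b : Fin n → ℤ} {f : Laurent R n} (hf : Setting Δ μ S L b f)
    {p : ℕ} (hp : p.Prime) [IsAdicComplete (Ideal.span {(p : R)}) R] {σ : R →+* R}
    (hσ : IsFrobeniusLift p σ) {a : Formal R n} (ha : a ∈ OmegaHat p f b μ) :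
    cartier p a ∈ leadingSup p (DworkCrystal.twist σ f) b μ S := by
  have hp0 := hp.ne_zero
  set f' := DworkCrystal.twist σ f with hf'def
  have hf' : Setting Δ μ S L b f' := hf.twist σ
  by_cases hp2 : p = 2
  · subst hp2
    have key : ∀ s, ∃ d : S → R, ∃ w ∈ Omega f' b μ, ∃ e : Formal R n,
        cartier 2 a = ∑ v : S, d v • omega f' b v + ((2 : ℕ) : R) • (w + ((2 : ℕ) : R) ^ s • e) := by
      intro s
      obtain ⟨w, hw, e, he⟩ := (mem_omegaHat_two f b μ a).1 ha (s + 1)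
      obtain ⟨d, z, hz, hdz⟩ := mem_leadingSup.1 (hf.cartier_omega_mem hp hσ hw)
      obtain ⟨w', hw', e', he'⟩ := (mem_omegaHat_two f' b μ z).1 hz s
      refine ⟨d, w', hw', e' + cartier 2 e, ?_⟩
      rw [he, ← cartierLin_apply, map_add, map_smul, cartierLin_apply, hdz, he', cartierLin_apply,
        pow_succ', mul_smul, smul_add, smul_add, smul_add, smul_add]
      abel
    choose d w hw e he using key
    refine mem_leadingSup.2 ⟨d 0, w 0 + e 0, (mem_omegaHat_two f' b μ _).2 fun s => ?_, by
      rw [he 0, pow_zero, one_smul]⟩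
    -- The leading coefficients d s depend on the approximation. The dual functionals show d s ≡ d 0
    -- modulo 2, so replacing d s by d 0 changes the remainder only by a combination of the ω_v.
    have hdiff : ∑ v : S, (d s v - d 0 v) • omega f' b v =
        ((2 : ℕ) : R) • ((w 0 + e 0) - (w s + ((2 : ℕ) : R) ^ s • e s)) := by
      have h1 := (he s).symm.trans (he 0)
      rw [pow_zero, one_smul] at h1
      simp only [sub_smul, Finset.sum_sub_distrib]
      rw [smul_sub, sub_eq_sub_iff_add_eq_add, h1]
      abel
    have hdvd : ∀ v, ∃ q, d s v - d 0 v = ((2 : ℕ) : R) * q := by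
      intro v
      have h1 := hf'.vertex.ct_sum_omega (fun v => d s v - d 0 v) v
      rw [hdiff, map_smul] at h1
      exact ⟨_, h1.symm⟩
    choose q hq using hdvd
    refine ⟨∑ v : S, q v • omega f' b v + w s, add_mem (Submodule.sum_mem _ fun v _ =>
      Submodule.smul_mem _ _ (hf'.omega_mem v.2)) (hw s), e s, smul_cancel hp0 ?_⟩
    simp only [hq, mul_smul] at hdiff
    rw [← Finset.smul_sum] at hdiff
    have h2 := smul_cancel hp0 hdiff
    rw [h2]
    congr 1
    abel
  -- The summand z absorbs the remainders, so X is stable under x = θ + p y: C_p sends w + p a' to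
  -- C_p(w) + p C_p(a'), and C_p(w) + z is split again.
  · set X : Set (Formal R n) :=
      {x | ∃ a ∈ OmegaHat p f b μ, ∃ z ∈ OmegaHat p f' b μ, x = cartier p a + z} with hX
    have hmem : ∀ a ∈ OmegaHat p f b μ, cartier p a ∈ OmegaHat p f' b μ := by
      intro a ha
      refine mem_omegaHat_of_chain hp2 X ?_ ⟨a, ha, 0, zero_mem _, (add_zero _).symm⟩
      rintro _ ⟨a, ha, z, hz, rfl⟩
      obtain ⟨w, hw, a', ha', rfl⟩ := exists_chain_of_mem_omegaHat hp0 hp2 ha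
      obtain ⟨θ, hθ, z', hz', h⟩ := exists_chain_of_mem_omegaHat hp0 hp2
        (add_mem (hf'.leadingSup_le p (hf.cartier_omega_mem hp hσ hw)) hz)
      refine ⟨θ, hθ, cartier p a' + z', ⟨a', ha', z', hz', rfl⟩, ?_⟩
      rw [← cartierLin_apply, map_add, map_smul, cartierLin_apply, cartierLin_apply, smul_add,
        add_right_comm, h]
      abel
    obtain ⟨w, hw, a', ha', rfl⟩ := exists_chain_of_mem_omegaHat hp0 hp2 ha
    rw [← cartierLin_apply, map_add, map_smul, cartierLin_apply, cartierLin_apply]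
    refine add_mem (hf.cartier_omega_mem hp hσ hw) (Submodule.mem_sup_right ?_)
    exact (Submodule.mem_smul_pointwise_iff_exists _ _ _).2 ⟨_, hmem a' ha', rfl⟩

end

/-! ### Functoriality in the coefficients -/

theorem toHahn_twist (σ : R →+* R) (L : (Fin n → ℤ) →+ ℝ) (P : Laurent R n) :
    toHahn L (twist σ P) = (toHahn L P).map σ := by
  induction P using AddMonoidAlgebra.induction_linear with
  | zero => ext γ; simp [twist]
  | add f g hf hg => rw [twist_add, map_add, map_add, hf, hg]; ext γ; simp
  | single v c =>
    rw [twist_single, toHahn_single, toHahn_single]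
    ext γ
    classical
    simp only [HahnSeries.map_coeff, HahnSeries.coeff_single]
    split_ifs <;> simp

/-- Applying σ to the inverse of f gives an inverse of f^σ, and inverses are unique. -/
theorem IsVertexUnit.omega_twist {L : (Fin n → ℤ) →+ ℝ} {b : Fin n → ℤ} {f : Laurent R n}
    (hf : IsVertexUnit L b f) (σ : R →+* R) (u : Fin n → ℤ) :
    omega (DworkCrystal.twist σ f) b u = fun w => σ (omega f b u w) := by
  have hmul : ∀ x y : Hahn R n, (x * y).map σ = x.map σ * y.map σ := fun x y =>
    HahnSeries.map_mul (σ : R →ₙ+* R)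
  have h1 : (fun w => σ (omega f b u w)) =
      toFormal L ((toHahn L (AddMonoidAlgebra.single u 1) * invHahn L f).map σ) := by
    rw [omega, hf.expansion_eq, pow_one]
    rfl
  rw [h1, omega, (hf.twist σ).expansion_eq, pow_one]
  congr 1
  have h2 : toHahn L (AddMonoidAlgebra.single u (1 : R)) =
      (toHahn L (AddMonoidAlgebra.single u (1 : R))).map σ := by
    rw [← toHahn_twist, twist_single, map_one]
  rw [hmul, ← h2]
  have h3 : toHahn L (DworkCrystal.twist σ f) * (invHahn L f).map σ = 1 := by
    rw [toHahn_twist, ← hmul, hf.mul_invHahn]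
    exact HahnSeries.map_one σ.toMonoidWithZeroHom
  have h4 := (hf.twist σ).mul_invHahn
  congr 1
  linear_combination (invHahn L f).map σ * h4 - invHahn L (DworkCrystal.twist σ f) * h3

theorem ct_twist (σ : R →+* R) (P : Laurent R n) (a : Formal R n) :
    ct (twist σ P) (fun w => σ (a w)) = σ (ct P a) := by
  induction P using AddMonoidAlgebra.induction_linear with
  | zero => simp [twist, ct_apply, polyMul_zero_left]
  | add f g hf hg => rw [twist_add, ct_add_left, ct_add_left, hf, hg, map_add]
  | single v c =>
    rw [twist_single, ct_apply, ct_apply, polyMul_single, polyMul_single, map_mul]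

/-! ### The matrices `γ_m` -/

/-- The Laurent polynomial `φ_v^m - (φ_v - f / x^v)^m`. -/
def gammaPoly (f : Laurent R n) (φ : (Fin n → ℤ) → R) (m : ℕ) (v : Fin n → ℤ) : Laurent R n :=
  AddMonoidAlgebra.single 0 (φ v) ^ m -
    (AddMonoidAlgebra.single 0 (φ v) - f * AddMonoidAlgebra.single (-v) 1) ^ m

/-- The matrix `γ_m` with rows and columns indexed by a finite set of exponents. -/
def gammaOn (S : Finset (Fin n → ℤ)) (f : Laurent R n) (b : Fin n → ℤ) (φ : (Fin n → ℤ) → R)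
    (m : ℕ) : Matrix S S R :=
  fun u v => ct (gammaPoly f φ m v) (omega f b u)

theorem twist_gammaPoly (σ : R →+* R) (f : Laurent R n) (φ : (Fin n → ℤ) → R) (m : ℕ)
    (v : Fin n → ℤ) :
    twist σ (gammaPoly f φ m v) = gammaPoly (twist σ f) (fun u => σ (φ u)) m v := by
  simp only [gammaPoly, twist_sub, twist_pow, twist_mul, twist_single, map_one]

theorem IsVertexUnit.gammaOn_twist {L : (Fin n → ℤ) →+ ℝ} {b : Fin n → ℤ} {f : Laurent R n}
    (hf : IsVertexUnit L b f) (S : Finset (Fin n → ℤ)) (σ : R →+* R) (φ : (Fin n → ℤ) → R)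
    (m : ℕ) : gammaOn S (DworkCrystal.twist σ f) b (fun u => σ (φ u)) m =
      (gammaOn S f b φ m).map σ := by
  ext u v
  rw [gammaOn, ← twist_gammaPoly, hf.omega_twist, ct_twist]
  rfl

theorem IsVertexUnit.gammaOn_one {L : (Fin n → ℤ) →+ ℝ} {b : Fin n → ℤ} {f : Laurent R n}
    (hf : IsVertexUnit L b f) (S : Finset (Fin n → ℤ)) (φ : (Fin n → ℤ) → R) :
    gammaOn S f b φ 1 = 1 := by
  ext u v
  rw [gammaOn, gammaPoly, pow_one, pow_one, sub_sub_cancel, hf.ct_omega, Matrix.one_apply]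
  simp only [Subtype.ext_iff]

theorem ct_gammaPoly_sum (S : Finset (Fin n → ℤ)) (f : Laurent R n) (b : Fin n → ℤ)
    (φ : (Fin n → ℤ) → R) (m : ℕ) (c : S → R) (v : S) :
    ct (gammaPoly f φ m v) (∑ u : S, c u • omega f b u) =
      Matrix.vecMul c (gammaOn S f b φ m) v := by
  rw [map_sum]
  exact Finset.sum_congr rfl fun u _ => by rw [map_smul]; rfl

theorem pow_dvd_gammaPoly_sub_frob {p : ℕ} (hp : p.Prime) {σ : R →+* R}
    (hσ : IsFrobeniusLift p σ) (f : Laurent R n) (φ : (Fin n → ℤ) → R) (s m : ℕ)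
    (v : Fin n → ℤ) : (p : Laurent R n) ^ (s + 1) ∣ gammaPoly f φ (p ^ (s + 1) * m) v -
      frob p (gammaPoly (twist σ f) (fun u => σ (φ u)) (p ^ s * m) v) := by
  have h1 := pow_dvd_pow_sub_frob_twist hp hσ (AddMonoidAlgebra.single (0 : Fin n → ℤ) (φ v)) s m
  have h2 := pow_dvd_pow_sub_frob_twist hp hσ
    (AddMonoidAlgebra.single 0 (φ v) - f * AddMonoidAlgebra.single (-v) 1) s m
  convert h1.sub h2 using 1
  rw [← twist_gammaPoly, gammaPoly, gammaPoly, twist_sub, map_sub]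
  ring

theorem IsFormallyExact.pow_dvd_ct_gammaPoly [IsDomain R] [CharZero R] {p : ℕ} (hp : p.Prime)
    {σ : R →+* R} (hσ : IsFrobeniusLift p σ) (f : Laurent R n) (φ : (Fin n → ℤ) → R) (s m : ℕ)
    (v : Fin n → ℤ) {a : Formal R n} (ha : IsFormallyExact p a) :
    (p : R) ^ s ∣ ct (gammaPoly f φ (p ^ s * m) v) a := by
  rw [gammaPoly, ct_sub_left]
  exact (ha.pow_dvd_ct_pow hp hσ s m _ a).sub (ha.pow_dvd_ct_pow hp hσ s m _ a)

/-- The derivative of an m-th power is divisible by m. -/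
theorem pow_dvd_coeffDer_gammaPoly (δ : Derivation ℤ R R) (f : Laurent R n)
    (φ : (Fin n → ℤ) → R) (p s m : ℕ) (v : Fin n → ℤ) :
    (p : Laurent R n) ^ s ∣ coeffDer δ (gammaPoly f φ (p ^ s * m) v) := by
  have h : ∀ P : Laurent R n, (p : Laurent R n) ^ s ∣ coeffDer δ (P ^ (p ^ s * m)) := fun P => by
    refine Dvd.dvd.trans ?_ (natCast_dvd_coeffDer_pow δ P (p ^ s * m))
    push_cast
    exact dvd_mul_right _ _
  rw [gammaPoly, map_sub]
  exact (h _).sub (h _)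

/-- If `C_p(ω_u) = ∑_v Λ_{u,v} ω_v^σ + p e_u`, then `γ_{pm} ≡ Λ σ(γ_m)` modulo `p^{s+1}` as soon as
the constant terms against `e_u` are divisible by `p^s`. -/
theorem pow_dvd_gammaOn_sub {p : ℕ} (hp : p.Prime) {σ : R →+* R} (hσ : IsFrobeniusLift p σ)
    {S : Finset (Fin n → ℤ)} {f : Laurent R n} {b : Fin n → ℤ} (φ : (Fin n → ℤ) → R)
    (s m : ℕ) {Λ : Matrix S S R} {e : S → Formal R n}
    (hΛ : ∀ u : S, cartier p (omega f b u) =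
      ∑ v : S, Λ u v • omega (twist σ f) b v + (p : R) • e u)
    (he : ∀ u v : S, (p : R) ^ s ∣
      ct (gammaPoly (twist σ f) (fun u => σ (φ u)) (p ^ s * m) v) (e u)) (u v : S) :
    (p : R) ^ (s + 1) ∣ gammaOn S f b φ (p ^ (s + 1) * m) u v -
      (Λ * gammaOn S (twist σ f) b (fun u => σ (φ u)) (p ^ s * m)) u v := by
  have h1 := natCast_pow_dvd_ct (pow_dvd_gammaPoly_sub_frob hp hσ f φ s m v) (omega f b u)
  rw [ct_sub_left, ct_frob, hΛ, map_add, map_smul, ct_gammaPoly_sum] at h1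
  have h2 := mul_dvd_mul_left (p : R) (he u v)
  rw [← pow_succ'] at h2
  have h3 := h1.add h2
  rw [smul_eq_mul, ← sub_sub, sub_add_cancel] at h3
  exact h3

/-! ### Invertible matrices -/

/-- The determinants agree modulo p. -/
theorem Matrix.isUnit_of_dvd_sub {ι : Type*} [Fintype ι] [DecidableEq ι] {p : ℕ}
    [IsAdicComplete (Ideal.span {(p : R)}) R] {A B : Matrix ι ι R} (hA : IsUnit A)
    (h : ∀ i j, (p : R) ∣ A i j - B i j) : IsUnit B := by
  rw [Matrix.isUnit_iff_isUnit_det] at hA ⊢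
  refine DworkCrystal.isUnit_of_dvd_sub (p := p) hA ?_
  rw [← Ideal.mem_span_singleton, ← Ideal.Quotient.eq, RingHom.map_det, RingHom.map_det]
  congr 1
  ext i j
  exact (Ideal.Quotient.eq).2 (Ideal.mem_span_singleton.2 (h i j))

theorem Matrix.dvd_of_dvd_vecMul {ι : Type*} [Fintype ι] [DecidableEq ι] {d : R}
    {A : Matrix ι ι R} (hA : IsUnit A) {c : ι → R} (h : ∀ j, d ∣ Matrix.vecMul c A j) (i : ι) :
    d ∣ c i := by
  have h1 : Matrix.vecMul (Matrix.vecMul c A) A⁻¹ = c := by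
    rw [Matrix.vecMul_vecMul, Matrix.mul_nonsing_inv _ ((Matrix.isUnit_iff_isUnit_det A).1 hA),
      Matrix.vecMul_one]
  rw [← h1]
  exact Finset.dvd_sum fun j _ => (h j).mul_right _

theorem isUnit_map_matrix {ι : Type*} [Fintype ι] [DecidableEq ι] {A : Matrix ι ι R}
    (hA : IsUnit A) (σ : R →+* R) : IsUnit (A.map σ) :=
  hA.map (RingHom.mapMatrix σ)

theorem MatCongr.mul_inv {ι : Type*} [Fintype ι] [DecidableEq ι] {d : R} {A B C : Matrix ι ι R}
    (h : MatCongr d A (C * B)) (hB : IsUnit B) : MatCongr d C (A * B⁻¹) := by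
  intro i j
  have h1 : C - A * B⁻¹ = -((A - C * B) * B⁻¹) := by
    rw [sub_mul, mul_assoc, Matrix.mul_nonsing_inv _ ((Matrix.isUnit_iff_isUnit_det B).1 hB),
      mul_one, neg_sub]
  rw [← Matrix.sub_apply, h1, Matrix.neg_apply, dvd_neg, Matrix.mul_apply]
  exact Finset.dvd_sum fun k _ => (h i k).mul_right _

/-! ### Limits -/

theorem exists_limit {p : ℕ} [IsAdicComplete (Ideal.span {(p : R)}) R] (c : ℕ → R)
    (h : ∀ s, (p : R) ^ s ∣ c (s + 1) - c s) : ∃ l, ∀ s, (p : R) ^ s ∣ l - c s := by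
  have hmono : ∀ s t, s ≤ t → (p : R) ^ s ∣ c t - c s := by
    intro s t hst
    induction t, hst using Nat.le_induction with
    | base => simp
    | succ t hst ih =>
      have := ((pow_dvd_pow (p : R) hst).trans (h t)).add ih
      rwa [sub_add_sub_cancel] at this
  obtain ⟨l, hl⟩ := IsPrecomplete.prec (I := Ideal.span {(p : R)}) (M := R) inferInstance (f := c)
    fun {s t} hst => by
      rw [SModEq.sub_mem, smul_eq_mul, Ideal.mul_top, Ideal.span_singleton_pow,
        Ideal.mem_span_singleton, ← neg_sub, dvd_neg]
      exact hmono s t hst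
  refine ⟨l, fun s => ?_⟩
  have := hl s
  rwa [SModEq.sub_mem, smul_eq_mul, Ideal.mul_top, Ideal.span_singleton_pow,
    Ideal.mem_span_singleton, ← neg_sub, dvd_neg] at this

theorem eq_zero_of_forall_pow_dvd {p : ℕ} [IsAdicComplete (Ideal.span {(p : R)}) R] {x : R}
    (h : ∀ s, (p : R) ^ s ∣ x) : x = 0 := by
  refine IsHausdorff.haus (I := Ideal.span {(p : R)}) (M := R) inferInstance x fun s => ?_
  rw [SModEq.sub_mem, sub_zero, smul_eq_mul, Ideal.mul_top, Ideal.span_singleton_pow,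
    Ideal.mem_span_singleton]
  exact h s

/-! ### The modules U and the congruences for the matrices γ_m -/

section

theorem twist_pow_succ (σ : R →+* R) (s : ℕ) (f : Laurent R n) :
    twist σ (twist (σ ^ s) f) = twist (σ ^ (s + 1)) f := by
  rw [twist_twist, pow_succ']
  rfl

/-- The constant-term congruences only use divisibility of the Cartier iterates, not membership of
the quotients in the completion. -/
theorem isFormallyExact_of_mem_U {p : ℕ} {σ : R →+* R} {f : Laurent R n} {b : Fin n → ℤ}
    {μ : Set (Fin n → ℝ)} {a : Formal R n} (ha : a ∈ U p σ f b μ) : IsFormallyExact p a := by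
  intro s
  rcases Nat.eq_zero_or_pos s with rfl | hs
  · exact ⟨a, by simp⟩
  · obtain ⟨c, -, hc⟩ := ha.2 s hs
    exact ⟨c, by rw [← cartier_iterate, hc]⟩

theorem smul_mem_U {p : ℕ} {σ : R →+* R} {f : Laurent R n} {b : Fin n → ℤ}
    {μ : Set (Fin n → ℝ)} {a : Formal R n} (ha : a ∈ U p σ f b μ) (r : R) :
    r • a ∈ U p σ f b μ := by
  refine ⟨Submodule.smul_mem _ r ha.1, fun s hs => ?_⟩
  obtain ⟨c, hc, hac⟩ := ha.2 s hs
  refine ⟨r • c, Submodule.smul_mem _ r hc, ?_⟩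
  rw [cartier_iterate] at hac ⊢
  rw [map_smul, hac, smul_comm]

variable {Δ μ : Set (Fin n → ℝ)} {S : Finset (Fin n → ℤ)} {L : (Fin n → ℤ) →+ ℝ}
  {b : Fin n → ℤ} {f : Laurent R n} {p : ℕ} {σ : R →+* R}

/-- Modulo p nothing is required of the error terms e, so this is available before the decomposition
by U. -/
theorem Setting.dvd_gammaOn_sub (hf : Setting Δ μ S L b f) (hp : p.Prime)
    (hσ : IsFrobeniusLift p σ) (φ : (Fin n → ℤ) → R) (m : ℕ) {Λ : Matrix S S R}
    {e : S → Formal R n} (hΛ : ∀ u : S, cartier p (omega f b u) =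
      ∑ v : S, Λ u v • omega (DworkCrystal.twist σ f) b v + (p : R) • e u) (u v : S) :
    (p : R) ∣ gammaOn S f b φ (p * m) u v - (Λ * (gammaOn S f b φ m).map σ) u v := by
  have h := pow_dvd_gammaOn_sub hp hσ φ 0 m hΛ (fun _ _ => by rw [pow_zero]; exact one_dvd _) u v
  rwa [zero_add, pow_one, pow_one, pow_zero, one_mul, hf.vertex.gammaOn_twist] at h

theorem Setting.isUnit_gammaOn_twist (hf : Setting Δ μ S L b f) {φ : (Fin n → ℤ) → R} {m : ℕ}
    (hγ : IsUnit (gammaOn S f b φ m)) (τ : R →+* R) :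
    IsUnit (gammaOn S (DworkCrystal.twist τ f) b (fun u => τ (φ u)) m) := by
  rw [hf.vertex.gammaOn_twist]
  exact isUnit_map_matrix hγ τ

/-- The case m = 1 gives γ_p ≡ Λ modulo p, because γ_1 = 1. -/
theorem Setting.isUnit_leadingMatrix [IsAdicComplete (Ideal.span {(p : R)}) R]
    (hf : Setting Δ μ S L b f) (hp : p.Prime)
    (hσ : IsFrobeniusLift p σ) {φ : (Fin n → ℤ) → R} (hγ : IsUnit (gammaOn S f b φ p))
    {Λ : Matrix S S R} {e : S → Formal R n} (hΛ : ∀ u : S, cartier p (omega f b u) =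
      ∑ v : S, Λ u v • omega (DworkCrystal.twist σ f) b v + (p : R) • e u) : IsUnit Λ := by
  refine Matrix.isUnit_of_dvd_sub (p := p) hγ fun u v => ?_
  have h := hf.dvd_gammaOn_sub hp hσ φ 1 hΛ u v
  rwa [hf.vertex.gammaOn_one, Matrix.map_one _ (map_zero σ) (map_one σ), mul_one, mul_one] at h

variable [IsDomain R] [CharZero R]

theorem Setting.matCongr_gammaOn (hf : Setting Δ μ S L b f) (hp : p.Prime)
    (hσ : IsFrobeniusLift p σ) (φ : (Fin n → ℤ) → R) {Λ : Matrix S S R} {e : S → Formal R n}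
    (he : ∀ u, e u ∈ U p σ (DworkCrystal.twist σ f) b μ)
    (hΛ : ∀ u : S, cartier p (omega f b u) =
      ∑ v : S, Λ u v • omega (DworkCrystal.twist σ f) b v + (p : R) • e u) {m : ℕ} (hm : 1 ≤ m) :
    MatCongr ((p : R) ^ padicValNat p m) (gammaOn S f b φ m)
      (Λ * (gammaOn S f b φ (m / p)).map σ) := by
  intro u v
  rcases Nat.eq_zero_or_pos (padicValNat p m) with h0 | h0
  · rw [h0, pow_zero]
    exact one_dvd _
  · obtain ⟨s, hs⟩ : ∃ s, padicValNat p m = s + 1 := ⟨padicValNat p m - 1, by omega⟩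
    have hdvd : p ^ (s + 1) ∣ m := hs ▸ pow_padicValNat_dvd
    obtain ⟨m', rfl⟩ := hdvd
    have hdiv : p ^ (s + 1) * m' / p = p ^ s * m' := by
      rw [pow_succ', mul_assoc, Nat.mul_div_cancel_left _ hp.pos]
    rw [hs, hdiv, ← hf.vertex.gammaOn_twist]
    have he' : ∀ u v : S, (p : R) ^ s ∣
        ct (gammaPoly (DworkCrystal.twist σ f) (fun u => σ (φ u)) (p ^ s * m') v) (e u) :=
      fun u v => IsFormallyExact.pow_dvd_ct_gammaPoly hp hσ (DworkCrystal.twist σ f)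
        (fun u => σ (φ u)) s m' v (isFormallyExact_of_mem_U (he u))
    exact pow_dvd_gammaOn_sub hp hσ φ s m' hΛ he' u v

/-- Leibniz for the pairing: the term with δ on the polynomial dies modulo p^s, and in the other
term δ(ω_u) may be replaced by ∑ N ω_v modulo U. -/
theorem matCongr_der_gammaOn (hp : p.Prime) (hσ : IsFrobeniusLift p σ)
    (δ : Derivation ℤ R R) (φ : (Fin n → ℤ) → R) {N : Matrix S S R}
    (hN : ∀ u : S, (fun w => δ (omega f b u w)) - ∑ v : S, N u v • omega f b v ∈ U p σ f b μ)
    (m : ℕ) : MatCongr ((p : R) ^ padicValNat p m) ((gammaOn S f b φ m).map δ)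
      (N * gammaOn S f b φ m) := by
  intro u v
  obtain ⟨m', hm⟩ : p ^ padicValNat p m ∣ m := pow_padicValNat_dvd
  set s := padicValNat p m
  have h1 := (isFormallyExact_of_mem_U (hN u)).pow_dvd_ct_gammaPoly hp hσ f φ s m' v
  have h2 := natCast_pow_dvd_ct (pow_dvd_coeffDer_gammaPoly δ f φ p s m' v) (omega f b u)
  rw [map_sub, ct_gammaPoly_sum] at h1
  have h3 : δ (gammaOn S f b φ (p ^ s * m') u v) =
      ct (coeffDer δ (gammaPoly f φ (p ^ s * m') v)) (omega f b u) +
        ct (gammaPoly f φ (p ^ s * m') v) (fun w => δ (omega f b u w)) :=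
    congrFun (der_polyMul δ (gammaPoly f φ (p ^ s * m') v) (omega f b u)) 0
  rw [hm, Matrix.map_apply, h3, add_sub_assoc]
  exact h2.add h1

variable [IsAdicComplete (Ideal.span {(p : R)}) R]

/-! ### The leading matrix of the Cartier operator -/

theorem Setting.exists_leadingMatrix (hf : Setting Δ μ S L b f) (hp : p.Prime)
    (hσ : IsFrobeniusLift p σ) : ∃ (Λ : Matrix S S R) (e : S → Formal R n),
      (∀ u, e u ∈ OmegaHat p (DworkCrystal.twist σ f) b μ) ∧
      ∀ u : S, cartier p (omega f b u) =
        ∑ v : S, Λ u v • omega (DworkCrystal.twist σ f) b v + (p : R) • e u := by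
  have h := fun u : S => mem_leadingSup.1 (hf.cartier_omega_mem hp hσ (hf.omega_mem u.2))
  choose Λ e he h using h
  exact ⟨Λ, e, he, h⟩

/-- Induction through γ_(p^(s+1)) ≡ Λ σ(γ_(p^s)) modulo p with Λ invertible. -/
theorem Setting.isUnit_gammaOn_pow (hf : Setting Δ μ S L b f) (hp : p.Prime)
    (hσ : IsFrobeniusLift p σ) {φ : (Fin n → ℤ) → R} (hγ : IsUnit (gammaOn S f b φ p)) (s : ℕ) :
    IsUnit (gammaOn S f b φ (p ^ s)) := by
  obtain ⟨Λ, e, -, hΛ⟩ := hf.exists_leadingMatrix hp hσ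
  induction s with
  | zero => rw [pow_zero, hf.vertex.gammaOn_one]; exact isUnit_one
  | succ s ih =>
    refine Matrix.isUnit_of_dvd_sub (p := p)
      ((hf.isUnit_leadingMatrix hp hσ hγ hΛ).mul (isUnit_map_matrix ih σ)) fun u v => ?_
    rw [← neg_sub, dvd_neg, pow_succ']
    exact hf.dvd_gammaOn_sub hp hσ φ (p ^ s) hΛ u v

/-- A combination of the `ω_u` that is formally exact vanishes. -/
theorem Setting.eq_zero_of_isFormallyExact (hf : Setting Δ μ S L b f) (hp : p.Prime)
    (hσ : IsFrobeniusLift p σ) {φ : (Fin n → ℤ) → R} (hγ : IsUnit (gammaOn S f b φ p))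
    {c : S → R} (hc : IsFormallyExact p (∑ u : S, c u • omega f b u)) : c = 0 := by
  ext u
  -- Formal exactness makes c γ_(p^s) divisible by p^s; invertibility passes this to c.
  refine eq_zero_of_forall_pow_dvd (p := p) fun s => ?_
  refine Matrix.dvd_of_dvd_vecMul (hf.isUnit_gammaOn_pow hp hσ hγ s) (fun v => ?_) u
  have h := hc.pow_dvd_ct_gammaPoly hp hσ f φ s 1 v
  rwa [ct_gammaPoly_sum, mul_one] at h

/-! ### The decomposition of the completion of `Ω_f(μ)` -/

theorem Setting.iterate_cartier_mem (hf : Setting Δ μ S L b f) (hp : p.Prime)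
    (hσ : IsFrobeniusLift p σ) {a : Formal R n} (ha : a ∈ OmegaHat p f b μ) (s : ℕ) :
    (cartierLin p ^ s) a ∈ OmegaHat p (DworkCrystal.twist (σ ^ s) f) b μ := by
  induction s with
  | zero => rw [pow_zero, pow_zero, twist_one]; exact ha
  | succ s ih =>
    rw [pow_succ' (cartierLin p), Module.End.mul_apply, ← twist_pow_succ]
    have hf' := hf.twist (σ ^ s)
    exact (hf'.twist σ).leadingSup_le p (hf'.cartier_mem hp hσ ih)

/-- Any leading term can be reached by C_p^s modulo p, because the leading matrices of all twists of
f are invertible. -/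
theorem Setting.exists_iterate_cartier_eq (hf : Setting Δ μ S L b f) (hp : p.Prime)
    (hσ : IsFrobeniusLift p σ) {φ : (Fin n → ℤ) → R} (hγ : IsUnit (gammaOn S f b φ p)) (s : ℕ)
    (d : S → R) : ∃ c : S → R, ∃ z ∈ OmegaHat p (DworkCrystal.twist (σ ^ s) f) b μ,
      (cartierLin p ^ s) (∑ v : S, c v • omega f b v) =
        ∑ v : S, d v • omega (DworkCrystal.twist (σ ^ s) f) b v + (p : R) • z := by
  induction s generalizing d with
  | zero => exact ⟨d, 0, zero_mem _, by rw [pow_zero, pow_zero, twist_one]; simp⟩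
  | succ s ih =>
    have hf' := hf.twist (σ ^ s)
    obtain ⟨Λ, e, he, hΛ⟩ := hf'.exists_leadingMatrix hp hσ
    have hΛu : IsUnit Λ :=
      hf'.isUnit_leadingMatrix hp hσ (hf.isUnit_gammaOn_twist hγ (σ ^ s)) hΛ
    obtain ⟨c, z, hz, hc⟩ := ih (Matrix.vecMul d Λ⁻¹)
    have hd : Matrix.vecMul (Matrix.vecMul d Λ⁻¹) Λ = d := by
      rw [Matrix.vecMul_vecMul, Matrix.nonsing_inv_mul _ ((Matrix.isUnit_iff_isUnit_det Λ).1 hΛu),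
        Matrix.vecMul_one]
    set d' := Matrix.vecMul d Λ⁻¹ with hd'
    rw [← twist_pow_succ]
    refine ⟨c, ∑ u : S, d' u • e u + cartier p z, add_mem (Submodule.sum_mem _ fun u _ =>
      Submodule.smul_mem _ _ (he u)) ((hf'.twist σ).leadingSup_le p (hf'.cartier_mem hp hσ hz)), ?_⟩
    rw [pow_succ' (cartierLin p), Module.End.mul_apply, hc, map_add, map_sum, map_smul, cartierLin_apply p z,
      smul_add, ← add_assoc]
    congr 1
    have h1 : ∑ v : S, d v • omega (DworkCrystal.twist σ (DworkCrystal.twist (σ ^ s) f)) b v =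
        ∑ u : S, d' u • ∑ v : S, Λ u v •
          omega (DworkCrystal.twist σ (DworkCrystal.twist (σ ^ s) f)) b v := by
      rw [← hd]
      simp only [Matrix.vecMul, dotProduct, Finset.sum_smul, Finset.smul_sum, smul_smul]
      exact Finset.sum_comm
    rw [h1, Finset.smul_sum, ← Finset.sum_add_distrib]
    refine Finset.sum_congr rfl fun u _ => ?_
    rw [map_smul, cartierLin_apply, hΛ, smul_add, smul_comm (p : R)]

/-- Successive approximation in the style of Hensel: the coefficients are corrected by p^s e so that
divisibility of C_p^s by p^s improves to the next level, and the limit satisfies all levels at once.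
-/
theorem Setting.exists_sub_mem_U (hf : Setting Δ μ S L b f) (hp : p.Prime)
    (hσ : IsFrobeniusLift p σ) {φ : (Fin n → ℤ) → R} (hγ : IsUnit (gammaOn S f b φ p))
    {a : Formal R n} (ha : a ∈ OmegaHat p f b μ) :
    ∃ c : S → R, a - ∑ v : S, c v • omega f b v ∈ U p σ f b μ := by
  set Approx : ℕ → (S → R) → Prop := fun s c =>
    ∃ z ∈ OmegaHat p (DworkCrystal.twist (σ ^ s) f) b μ,
      (cartierLin p ^ s) (a - ∑ v : S, c v • omega f b v) = (p : R) ^ s • z with hA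
  have hstep : ∀ s c, Approx s c → ∃ e : S → R, Approx (s + 1) (c + (p : R) ^ s • e) := by
    rintro s c ⟨z, hz, hzc⟩
    have hf' := hf.twist (σ ^ s)
    obtain ⟨d, z', hz', hd⟩ := mem_leadingSup.1 (hf'.cartier_mem hp hσ hz)
    rw [twist_pow_succ] at hz' hd
    -- The correction e is chosen so that C_p^(s+1) of ∑ e_v ω_v has the same leading part d as
    -- C_p(z); the difference is then p(z' - y).
    obtain ⟨e, y, hy, he⟩ := hf.exists_iterate_cartier_eq hp hσ hγ (s + 1) d
    refine ⟨e, z' - y, sub_mem hz' hy, ?_⟩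
    have h1 : a - ∑ v : S, (c + (p : R) ^ s • e) v • omega f b v =
        (a - ∑ v : S, c v • omega f b v) - (p : R) ^ s • ∑ v : S, e v • omega f b v := by
      simp only [Pi.add_apply, Pi.smul_apply, smul_eq_mul, add_smul, mul_smul,
        Finset.sum_add_distrib, Finset.smul_sum]
      abel
    rw [h1, map_sub, map_smul, he, pow_succ' (cartierLin p), Module.End.mul_apply, hzc, map_smul,
      cartierLin_apply, hd, pow_succ (p : R), mul_smul, ← smul_sub, smul_sub (p : R)]
    congr 1
    abel
  choose! e he using hstep
  let c : ℕ → S → R := fun s => Nat.rec 0 (fun s c => c + (p : R) ^ s • e s c) s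
  have hc : ∀ s, Approx s (c s) := by
    intro s
    induction s with
    | zero => exact ⟨a, by rw [pow_zero, twist_one]; exact ha, by simp [c]⟩
    | succ s ih => exact he s _ ih
  have hlim : ∀ v, ∃ l, ∀ s, (p : R) ^ s ∣ l - c s v := fun v =>
    exists_limit (p := p) (fun s => c s v) fun s => by
      have : c (s + 1) v = c s v + (p : R) ^ s * e s (c s) v := rfl
      rw [this, add_sub_cancel_left]
      exact dvd_mul_right _ _
  choose l hl using hlim
  have hω : ∀ v : S, omega f b v ∈ OmegaHat p f b μ := fun v =>
    omega_le_omegaHat p f b μ (hf.omega_mem v.2)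
  refine ⟨l, sub_mem ha (Submodule.sum_mem _ fun v _ => Submodule.smul_mem _ _ (hω v)),
    fun s _ => ?_⟩
  obtain ⟨z, hz, hzc⟩ := hc s
  choose q hq using fun v => hl v s
  refine ⟨z - ∑ v : S, q v • (cartierLin p ^ s) (omega f b v), sub_mem hz
    (Submodule.sum_mem _ fun v _ => Submodule.smul_mem _ _
      (hf.iterate_cartier_mem hp hσ (hω v) s)), ?_⟩
  -- Since l - c_s is divisible by p^s, passing to the limit does not disturb level s.
  have h1 : a - ∑ v : S, l v • omega f b v =
      (a - ∑ v : S, c s v • omega f b v) - (p : R) ^ s • ∑ v : S, q v • omega f b v := by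
    have h2 : ∀ v, l v = c s v + (p : R) ^ s * q v := fun v => by rw [← hq]; ring
    simp only [h2, add_smul, mul_smul, Finset.sum_add_distrib, Finset.smul_sum]
    abel
  rw [cartier_iterate, h1, map_sub, hzc, map_smul, map_sum, smul_sub]
  simp only [map_smul]

/-! ### Existence, uniqueness and congruences -/

/-- Decomposing e, rather than C_p(ω_u), keeps the error in pU; this is the extra factor p needed in
the congruence for Λ. -/
theorem Setting.exists_cartierMatrix (hf : Setting Δ μ S L b f) (hp : p.Prime)
    (hσ : IsFrobeniusLift p σ) {φ : (Fin n → ℤ) → R} (hγ : IsUnit (gammaOn S f b φ p)) :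
    ∃ (Λ : Matrix S S R) (e : S → Formal R n),
      (∀ u, e u ∈ U p σ (DworkCrystal.twist σ f) b μ) ∧
      ∀ u : S, cartier p (omega f b u) =
        ∑ v : S, Λ u v • omega (DworkCrystal.twist σ f) b v + (p : R) • e u := by
  obtain ⟨Λ, e, he, hΛ⟩ := hf.exists_leadingMatrix hp hσ
  choose c hc using fun u => (hf.twist σ).exists_sub_mem_U hp hσ
    (hf.isUnit_gammaOn_twist hγ σ) (he u)
  refine ⟨fun u v => Λ u v + p * c u v, _, hc, fun u => ?_⟩
  rw [hΛ]
  simp only [add_smul, mul_smul, Finset.sum_add_distrib, smul_sub, Finset.smul_sum]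
  abel

/-- The difference of the two relations is a formally exact combination of the ω_v, hence zero. -/
theorem Setting.matrix_unique (hf : Setting Δ μ S L b f) (hp : p.Prime)
    (hσ : IsFrobeniusLift p σ) {φ : (Fin n → ℤ) → R} (hγ : IsUnit (gammaOn S f b φ p))
    {a : S → Formal R n} {A B : Matrix S S R}
    (hA : ∀ u, a u - ∑ v : S, A u v • omega f b v ∈ U p σ f b μ)
    (hB : ∀ u, a u - ∑ v : S, B u v • omega f b v ∈ U p σ f b μ) : A = B := by
  ext u v
  have h1 := (isFormallyExact_of_mem_U (hB u)).sub (isFormallyExact_of_mem_U (hA u))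
  have h2 : a u - ∑ v : S, B u v • omega f b v - (a u - ∑ v : S, A u v • omega f b v) =
      ∑ v : S, (A u v - B u v) • omega f b v := by
    simp only [sub_smul, Finset.sum_sub_distrib]
    abel
  rw [h2] at h1
  exact sub_eq_zero.1 (congrFun (hf.eq_zero_of_isFormallyExact hp hσ hγ h1) v)

end

end DworkCrystal

end

/-! ### The main theorem -/

theorem mainTheorem6 {R : Type*} [CommRing R] [IsDomain R] [CharZero R]
    (p : ℕ) (hp : p.Prime) [IsAdicComplete (Ideal.span {(p : R)}) R]
    {n : ℕ} (f : DworkCrystal.Laurent R n)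
    (b : Fin n → ℤ)
    (hb : DworkCrystal.toReal b ∈ (DworkCrystal.newtonPolytope f).extremePoints ℝ)
    (hfb : IsUnit (f.coeff b))
    (μ : Set (Fin n → ℝ)) (hμ : DworkCrystal.IsOpenIn (DworkCrystal.newtonPolytope f) μ)
    (φ : (Fin n → ℤ) → R)
    (hγ : IsUnit (DworkCrystal.gamma f b μ φ p))
    (σ : R →+* R) (hσ : DworkCrystal.IsFrobeniusLift p σ) (δ : Derivation ℤ R R) :
    (∃! Λ, DworkCrystal.IsLambda p σ f b μ Λ) ∧
    (∃! N, DworkCrystal.IsN p σ δ f b μ N) ∧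
    (∀ s : ℕ, IsUnit (DworkCrystal.gamma f b μ φ (p ^ s))) ∧
    ∀ Λ N, DworkCrystal.IsLambda p σ f b μ Λ → DworkCrystal.IsN p σ δ f b μ N →
      (∀ m : ℕ, 1 ≤ m →
        DworkCrystal.MatCongr ((p : R) ^ padicValNat p m)
          (DworkCrystal.gamma f b μ φ m)
          (Λ * (DworkCrystal.gamma f b μ φ (m / p)).map σ) ∧
        DworkCrystal.MatCongr ((p : R) ^ padicValNat p m)
          ((DworkCrystal.gamma f b μ φ m).map δ)
          (N * DworkCrystal.gamma f b μ φ m)) ∧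
      (∀ s : ℕ, 1 ≤ s →
        DworkCrystal.MatCongr ((p : R) ^ s) Λ
          (DworkCrystal.gamma f b μ φ (p ^ s) *
            ((DworkCrystal.gamma f b μ φ (p ^ (s - 1))).map σ)⁻¹) ∧
        DworkCrystal.MatCongr ((p : R) ^ s) N
          ((DworkCrystal.gamma f b μ φ (p ^ s)).map δ *
            (DworkCrystal.gamma f b μ φ (p ^ s))⁻¹)) := by
  set S := DworkCrystal.latticePoints f μ with hS
  obtain ⟨L, hL⟩ := DworkCrystal.exists_isVertexUnit hb hfb
  have hf : DworkCrystal.Setting (DworkCrystal.newtonPolytope f) μ S L b f :=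
    { convex := DworkCrystal.convex_newtonPolytope f
      isOpenIn := hμ
      mem_iff := fun u => by
        rw [hS, DworkCrystal.latticePoints, Set.Finite.mem_toFinset]
        exact ⟨fun h => h.2, fun h => ⟨hμ.1 h, h⟩⟩
      supp := fun u hu => by
        rw [Nat.cast_one, one_smul]
        exact DworkCrystal.toReal_mem_newtonPolytope (Finsupp.mem_support_iff.1 hu)
      vertex := hL }
  have hγ' : IsUnit (DworkCrystal.gammaOn S f b φ p) := hγ
  have hunit : ∀ s : ℕ, IsUnit (DworkCrystal.gamma f b μ φ (p ^ s)) :=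
    hf.isUnit_gammaOn_pow hp hσ hγ'
  obtain ⟨Λ₀, e, he, hΛ₀⟩ := hf.exists_cartierMatrix hp hσ hγ'
  have hΛ : DworkCrystal.IsLambda p σ f b μ Λ₀ := fun u => by
    rw [hΛ₀, add_sub_cancel_left]
    exact DworkCrystal.smul_mem_U (he u) _
  -- Uniqueness modulo U identifies any admissible Λ with Λ₀, so it inherits the sharper error term
  -- in pU.
  have huniq : ∀ Λ, DworkCrystal.IsLambda p σ f b μ Λ → Λ = Λ₀ := fun Λ h =>
    (hf.twist σ).matrix_unique hp hσ (hf.isUnit_gammaOn_twist hγ' σ) h hΛ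
  choose N₀ hN₀ using fun u : S => hf.exists_sub_mem_U hp hσ hγ'
    (DworkCrystal.omega_le_omegaHat p f b μ (hf.der_omega_mem δ u.2))
  have hcongr : ∀ Λ N, DworkCrystal.IsLambda p σ f b μ Λ → DworkCrystal.IsN p σ δ f b μ N →
      ∀ m : ℕ, 1 ≤ m →
        DworkCrystal.MatCongr ((p : R) ^ padicValNat p m) (DworkCrystal.gamma f b μ φ m)
          (Λ * (DworkCrystal.gamma f b μ φ (m / p)).map σ) ∧
        DworkCrystal.MatCongr ((p : R) ^ padicValNat p m) ((DworkCrystal.gamma f b μ φ m).map δ)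
          (N * DworkCrystal.gamma f b μ φ m) := by
    intro Λ N h hN m hm
    rw [huniq Λ h]
    exact ⟨hf.matCongr_gammaOn hp hσ φ he hΛ₀ hm, DworkCrystal.matCongr_der_gammaOn hp hσ δ φ hN m⟩
  refine ⟨⟨Λ₀, hΛ, huniq⟩, ⟨N₀, hN₀, fun N hN => hf.matrix_unique hp hσ hγ' hN hN₀⟩, hunit,
    fun Λ N h hN => ⟨hcongr Λ N h hN, fun s hs => ?_⟩⟩
  have := Fact.mk hp
  obtain ⟨h1, h2⟩ := hcongr Λ N h hN (p ^ s) (Nat.one_le_pow _ _ hp.pos)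
  obtain ⟨t, rfl⟩ : ∃ t, s = t + 1 := ⟨s - 1, by omega⟩
  rw [padicValNat.prime_pow] at h1 h2
  rw [show p ^ (t + 1) / p = p ^ t by rw [pow_succ, Nat.mul_div_cancel _ hp.pos]] at h1
  rw [Nat.add_sub_cancel]
  exact ⟨h1.mul_inv (DworkCrystal.isUnit_map_matrix (hunit t) σ), h2.mul_inv (hunit (t + 1))⟩
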